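/- Let $\mathbb T=\mathbb R/2\pi\mathbb Z$, $d\ge 2$, $\nu\in\mathbb N$, $s>d/2+1$, $\alpha\in(0,1)$ and $K>0$. For $\sigma\ge 0$ let $H^\sigma(\mathbb T^d,\mathbb R^n)$ be the Sobolev space with norm $\|u\|_{H^\sigma}=\big(\sum_{\xi\in\mathbb Z^d}\max\{1,|\xi|\}^{2\sigma}|\widehat u(\xi)|^2\big)^{1/2}$, where $\widehat u(\xi)=(2\pi)^{-d}\int_{\mathbb T^d}u(x)e^{-i x\cdot\xi}\,dx$; let $H^\sigma_0$ be its subspace of functions with zero average, and let $\mathfrak L$ be the Leray projector, that is, the $L^2$-orthogonal projector of $L^2(\mathbb T^d,\mathbb R^d)$ onto the fields with zero divergence. Then there exist $\delta\in(0,1)$ and $C>0$, depending only on $s,\alpha,d,\nu,K$, such that the following holds for every $\varepsilon\in(0,\delta)$. Let $\omega\in\mathbb R^\nu$, let $f:\mathbb T^\nu\times\mathbb T^d\to\mathbb R^d$ be continuous, and let $U\in C^1(\mathbb T^\nu,H^s(\mathbb T^d,\mathbb R^d))$, $P\in C^0(\mathbb T^\nu,H^s(\mathbb T^d,\mathbb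 R))$ be such that $\int_{\mathbb T^\nu\times\mathbb T^d}U(\varphi,x)\,d\varphi\,dx=0$, $\int_{\mathbb T^d}P(\varphi,x)\,dx=0$ for all $\varphi$, $$\|U(\varphi)\|_{H^s},\ \|\partial_{\varphi_k}U(\varphi)\|_{H^s},\ \|P(\varphi)\|_{H^s}\le K\varepsilon\qquad\text{for all }\varphi\in\mathbb T^\nu,\ 1\le k\le\nu,$$ and such that $u_\omega(t,x)=U(\omega t,x)$, $p_\omega(t,x)=P(\omega t,x)$ solve, for $t\in\mathbb R$, the Navier-Stokes equation $$\partial_t u-\Delta u+u\cdot\nabla u+\nabla p=\varepsilon f(\omega t,x),\qquad \operatorname{div}u=0 .$$ Then for every $v_0\in H^s_0(\mathbb T^d,\mathbb R^d)$ with $\operatorname{div}v_0=0$ and $\|v_0\|_{H^s}\le\delta$ there exists a unique global classical solution $$v\in C^0_b\big([0,+\infty),H^s_0(\mathbb T^d,\mathbb R^d)\big)\cap C^1_b\big([0,+\infty),H^{s-2}_0(\mathbb T^d,\mathbb R^d)\big)$$ of $$\partial_t v-\Delta v+\mathfrak L\big(u_\omega\cdot\nabla v+v\cdot\nabla u_\omega+v\cdot\nabla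 v\big)=0,\qquad \operatorname{div}v=0,\qquad v(0)=v_0 ,$$ (the equation holding in $H^{s-2}$ for every $t\ge0$), and it satisfies $$\|v(t)\|_{H^s},\ \|\partial_t v(t)\|_{H^{s-2}}\le C\,\delta\,e^{-\alpha t}\qquad\text{for all }t\ge 0 .$$ Uniqueness holds among all solutions in this class with the given initial datum. -/

import Mathlib

namespace NSTorus

open MeasureTheory Filter Topology

noncomputable section

/-! ### The torus, square integrable fields, Fourier coefficients -/

instance instFactTwoPiPos : Fact (0 < 2 * Real.pi) := ⟨Real.two_pi_pos⟩

/-- The torus `𝕋^m = (ℝ / 2πℤ)^m`, with its Lebesgue measure `volume` of total mass `(2π)^m`. -/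
abbrev Torus (m : ℕ) : Type := Fin m → AddCircle (2 * Real.pi)

/-- `ℝ^n` with the Euclidean norm. -/
abbrev Vec (n : ℕ) : Type := EuclideanSpace ℝ (Fin n)

/-- `L²(𝕋^d, ℝ^n)`. Scalar functions are the case `n = 1`. -/
abbrev L2 (d n : ℕ) : Type := Lp (Vec n) 2 (volume : Measure (Torus d))

/-- The character `x ↦ e^{i x · ξ}` of `𝕋^d`. -/
def character {d : ℕ} (ξ : Fin d → ℤ) : C(Torus d, ℂ) where
  toFun x := ∏ j, fourier (T := 2 * Real.pi) (ξ j) (x j)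
  continuous_toFun := by fun_prop

/-- The Fourier coefficient `û(ξ) = (2π)^{-d} ∫ u(x) e^{-i x · ξ} dx ∈ ℂ^n`. -/
def coeff {d n : ℕ} (u : L2 d n) (ξ : Fin d → ℤ) : EuclideanSpace ℂ (Fin n) :=
  WithLp.toLp 2 fun i =>
    (((2 * Real.pi) ^ d : ℝ) : ℂ)⁻¹ * ∫ x : Torus d, ((u x i : ℝ) : ℂ) * character (-ξ) x

/-- `u` has zero average: `∫ u(x) dx = 0`. -/
def ZeroMean {d n : ℕ} (u : L2 d n) : Prop := ∫ x : Torus d, u x = 0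

/-- The function of `L²(𝕋^d, ℝ^n)` given by `g`
(it is used below only for fields `g` that are square integrable; otherwise the value is `0`). -/
def toL2 {d n : ℕ} (g : Torus d → Vec n) : L2 d n :=
  open Classical in if h : MemLp g 2 volume then h.toLp g else 0

/-! ### Sobolev spaces -/

/-- `⟨ξ⟩ = max {1, |ξ|}`, with `|ξ|` the Euclidean norm. -/
def bracket {d : ℕ} (ξ : Fin d → ℤ) : ℝ := max 1 (Real.sqrt (∑ j, (ξ j : ℝ) ^ 2))

/-- `u ∈ H^s(𝕋^d, ℝ^n)`, for `s ≥ 0`. -/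
def MemHs {d n : ℕ} (s : ℝ) (u : L2 d n) : Prop :=
  Summable fun ξ : Fin d → ℤ => bracket ξ ^ (2 * s) * ‖coeff u ξ‖ ^ 2

/-- `‖u‖_{H^s} = (∑_ξ ⟨ξ⟩^{2s} |û(ξ)|²)^{1/2}`, meaningful when `MemHs s u`. -/
def hsNorm {d n : ℕ} (s : ℝ) (u : L2 d n) : ℝ :=
  Real.sqrt (∑' ξ : Fin d → ℤ, bracket ξ ^ (2 * s) * ‖coeff u ξ‖ ^ 2)

/-- The curve (or family) `v` takes values in `H^s` on the set `A` and is continuous there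
for the norm of `H^s`. -/
def ContHs {X : Type*} [TopologicalSpace X] {d n : ℕ} (s : ℝ) (A : Set X) (v : X → L2 d n) :
    Prop :=
  (∀ t ∈ A, MemHs s (v t)) ∧
    ∀ t ∈ A, Tendsto (fun τ => hsNorm s (v τ - v t)) (𝓝[A] t) (𝓝 0)

/-- `v ∈ C^0_b(A, H^s(𝕋^d, ℝ^n))`. -/
def ContBddHs {X : Type*} [TopologicalSpace X] {d n : ℕ} (s : ℝ) (A : Set X) (v : X → L2 d n) :
    Prop :=
  ContHs s A v ∧ ∃ M : ℝ, ∀ t ∈ A, hsNorm s (v t) ≤ M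

/-- `w` is the derivative at time `t` of `v : I → H^s`, for the norm of `H^s`
(one-sided at an end point of the interval `I`). -/
def HasTimeDeriv {d n : ℕ} (s : ℝ) (I : Set ℝ) (v : ℝ → L2 d n) (w : L2 d n) (t : ℝ) : Prop :=
  (∀ τ ∈ I, MemHs s (v τ)) ∧ MemHs s w ∧
    Tendsto (fun τ => hsNorm s ((τ - t)⁻¹ • (v τ - v t) - w)) (𝓝[I \ {t}] t) (𝓝 0)

/-- `v ∈ C^1_b(I, H^s(𝕋^d, ℝ^n))`, with time derivative `dv`. -/
def ContDiffBddHs {d n : ℕ} (s : ℝ) (I : Set ℝ) (v dv : ℝ → L2 d n) : Prop :=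
  ContBddHs s I v ∧ ContBddHs s I dv ∧ ∀ t ∈ I, HasTimeDeriv s I v (dv t) t

/-! ### Differential operators -/

/-- `g = ∂_j u` in the sense of distributions: `ĝ(ξ) = i ξ_j û(ξ)` for all `ξ`. -/
def IsPartial {d n : ℕ} (j : Fin d) (u g : L2 d n) : Prop :=
  ∀ ξ : Fin d → ℤ, coeff g ξ = (Complex.I * (ξ j : ℂ)) • coeff u ξ

/-- The derivative `∂_j u ∈ L²` (set to `0` if the distribution `∂_j u` is not in `L²`). -/
def partialD {d n : ℕ} (j : Fin d) (u : L2 d n) : L2 d n :=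
  open Classical in if h : ∃ g, IsPartial j u g then h.choose else 0

/-- The Laplacian `Δ u = ∑_j ∂_j ∂_j u`. -/
def lap {d n : ℕ} (u : L2 d n) : L2 d n := ∑ j : Fin d, partialD j (partialD j u)

/-- The gradient `∇ p` of a scalar function. -/
def grad {d : ℕ} (p : L2 d 1) : L2 d d :=
  toL2 fun x => WithLp.toLp 2 fun j => partialD j p x 0

/-- The vector field `u · ∇ v = ∑_j u_j ∂_j v`. -/
def advect {d : ℕ} (u v : L2 d d) : L2 d d :=
  toL2 fun x => ∑ j : Fin d, u x j • partialD j v x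

/-- The `i`-th component of a real field, as a complex function in `L²`. -/
def compC {d n : ℕ} (i : Fin n) : L2 d n →L[ℝ] Lp ℂ 2 (volume : Measure (Torus d)) :=
  ContinuousLinearMap.compLpL 2 volume
    (Complex.ofRealCLM.comp (EuclideanSpace.proj i : Vec n →L[ℝ] ℝ))

theorem coeff_eq_inner {d n : ℕ} (u : L2 d n) (ξ : Fin d → ℤ) (i : Fin n) :
    coeff u ξ i = (((2 * Real.pi) ^ d : ℝ) : ℂ)⁻¹ *
      inner ℂ (ContinuousMap.toLp (E := ℂ) 2 (volume : Measure (Torus d)) ℂ (character ξ))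
        (compC i u) := by
  unfold coeff
  simp only [L2.inner_def]
  congr 1
  refine integral_congr_ae ?_
  have h1 := ContinuousMap.coeFn_toLp (p := 2) (volume : Measure (Torus d)) (𝕜 := ℂ) (character ξ)
  have h2 := ContinuousLinearMap.coeFn_compLpL (p := 2) (μ := (volume : Measure (Torus d)))
    (Complex.ofRealCLM.comp (EuclideanSpace.proj i : Vec n →L[ℝ] ℝ)) u
  filter_upwards [h1, h2] with x hx1 hx2
  unfold compC
  rw [hx1, hx2]
  simp [character, map_prod]

theorem continuous_coeff {d n : ℕ} (ξ : Fin d → ℤ) (i : Fin n) :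
    Continuous fun u : L2 d n => coeff u ξ i := by
  simp only [coeff_eq_inner]
  fun_prop

/-- The space `𝒟₀(𝕋^d)` of the fields `u ∈ L²(𝕋^d, ℝ^d)` with `div u = 0` in the sense of
distributions, that is, `ξ · û(ξ) = 0` for all `ξ`. -/
def divFree (d : ℕ) : Submodule ℝ (L2 d d) where
  carrier := {u | ∀ ξ : Fin d → ℤ, ∑ j, (ξ j : ℂ) * coeff u ξ j = 0}
  zero_mem' := by
    intro ξ
    simp [coeff_eq_inner]
  add_mem' := by
    intro u v hu hv ξ
    have hu := hu ξ
    have hv := hv ξ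
    simp only [coeff_eq_inner] at hu hv ⊢
    simp only [map_add, inner_add_right, mul_add, Finset.sum_add_distrib]
    rw [hu, hv, add_zero]
  smul_mem' := by
    intro c u hu ξ
    have hu := hu ξ
    simp only [coeff_eq_inner] at hu ⊢
    have h : ∀ i : Fin d, compC i (c • u) = (c : ℂ) • compC i u := by
      intro i
      rw [map_smul]
      rfl
    simp only [h, inner_smul_right]
    have : ∀ x y z w : ℂ, x * (y * (z * w)) = z * (x * (y * w)) := by intros; ring
    simp only [this, ← Finset.mul_sum]
    rw [hu, mul_zero]

theorem isClosed_divFree (d : ℕ) : IsClosed (divFree d : Set (L2 d d)) := by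
  have : (divFree d : Set (L2 d d)) =
      ⋂ ξ : Fin d → ℤ, {u | ∑ j, (ξ j : ℂ) * coeff u ξ j = 0} := by
    ext u
    simp [divFree]
  rw [this]
  refine isClosed_iInter fun ξ => isClosed_eq ?_ continuous_const
  exact continuous_finsetSum _ fun j _ => continuous_const.mul (continuous_coeff ξ j)

instance instCompleteDivFree (d : ℕ) : CompleteSpace (divFree d) :=
  (isClosed_divFree d).completeSpace_coe

/-- The Leray projector: the `L²`-orthogonal projector onto `𝒟₀(𝕋^d)`. -/
def leray {d : ℕ} : L2 d d →L[ℝ] L2 d d := (divFree d).starProjection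

/-! ### Quasi-periodic solutions of the forced Navier-Stokes equation -/

/-- The point `ω t` of the torus `𝕋^ν`. -/
def flow {ν : ℕ} (ω : Fin ν → ℝ) (t : ℝ) : Torus ν :=
  fun k => ((ω k * t : ℝ) : AddCircle (2 * Real.pi))

/-- `V` is the partial derivative `∂_{φ_k} U` at `φ` of `U : 𝕋^ν → H^s`. -/
def HasAngleDeriv {ν d n : ℕ} (s : ℝ) (k : Fin ν) (U : Torus ν → L2 d n) (V : L2 d n)
    (φ : Torus ν) : Prop :=
  (∀ ψ, MemHs s (U ψ)) ∧ MemHs s V ∧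
    Tendsto (fun h : ℝ => hsNorm s
      (h⁻¹ • (U (φ + Pi.single k (h : AddCircle (2 * Real.pi))) - U φ) - V)) (𝓝[≠] 0) (𝓝 0)

/-- `U ∈ C^1(𝕋^ν, H^s)` and `‖U‖_{C^1 H^s} ≤ R`. -/
def C1Bound {ν d n : ℕ} (s R : ℝ) (U : Torus ν → L2 d n) : Prop :=
  ContHs s Set.univ U ∧ (∀ φ, hsNorm s (U φ) ≤ R) ∧
    ∃ DU : Fin ν → Torus ν → L2 d n, ∀ k,
      ContHs s Set.univ (DU k) ∧ (∀ φ, hsNorm s (DU k φ) ≤ R) ∧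
        ∀ φ, HasAngleDeriv s k U (DU k φ) φ

/-- The slice `f(φ, ·)` of a continuous function on `𝕋^ν × 𝕋^d`. -/
def slice {ν d : ℕ} (f : C(Torus ν × Torus d, Vec d)) (φ : Torus ν) : L2 d d :=
  ContinuousMap.toLp (E := Vec d) 2 (volume : Measure (Torus d)) ℝ (f.curry φ)

/-- `(u, p)` is a classical solution, for all times `t ∈ ℝ`, of
`∂_t u - Δ u + u · ∇ u + ∇ p = F(t)`, `div u = 0`; the equation holds in `H^{s-2}`. -/
def SolvesNavierStokes {d : ℕ} (s : ℝ) (F u : ℝ → L2 d d) (p : ℝ → L2 d 1) : Prop :=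
  ∀ t : ℝ, u t ∈ divFree d ∧
    ∃ du : L2 d d, HasTimeDeriv (s - 2) Set.univ u du t ∧
      du - lap (u t) + advect (u t) (u t) + grad (p t) = F t

/-- `(u_ω, p_ω)(t) = (U(ω t), P(ω t))` is a quasi-periodic solution of the Navier-Stokes equation
with forcing term `ε f(ω t, x)`, with `U ∈ C^1(𝕋^ν, H^s)`, `P ∈ C^0(𝕋^ν, H^s)`,
the normalizations `∫∫ U = 0`, `∫ P(φ, x) dx = 0`, and the size `‖U‖, ‖P‖ ≤ K ε`. -/
structure IsQuasiPeriodicSolution {ν d : ℕ} (s K ε : ℝ) (ω : Fin ν → ℝ)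
    (f : C(Torus ν × Torus d, Vec d)) (U : Torus ν → L2 d d) (P : Torus ν → L2 d 1) : Prop where
  regU : C1Bound s (K * ε) U
  regP : ContHs s Set.univ P
  boundP : ∀ φ, hsNorm s (P φ) ≤ K * ε
  meanU : ∫ φ : Torus ν, ∫ x : Torus d, U φ x = 0
  meanP : ∀ φ, ZeroMean (P φ)
  solves : SolvesNavierStokes s (fun t => ε • slice f (flow ω t))
    (fun t => U (flow ω t)) (fun t => P (flow ω t))

/-! ### The projected perturbation equation -/

/-- `v`, with time derivative `dv`, is a global classical solution in
`C^0_b([0,∞), H^s_0) ∩ C^1_b([0,∞), H^{s-2}_0)` of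
`∂_t v - Δ v + 𝔏(u · ∇ v + v · ∇ u + v · ∇ v) = 0`, `div v = 0`, `v(0) = v₀`. -/
structure IsPerturbationSolution {d : ℕ} (s : ℝ) (u : ℝ → L2 d d) (v₀ : L2 d d)
    (v dv : ℝ → L2 d d) : Prop where
  regC0 : ContBddHs s (Set.Ici 0) v
  regC1 : ContDiffBddHs (s - 2) (Set.Ici 0) v dv
  mean : ∀ t, 0 ≤ t → ZeroMean (v t)
  meanDeriv : ∀ t, 0 ≤ t → ZeroMean (dv t)
  div : ∀ t, 0 ≤ t → v t ∈ divFree d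
  eqn : ∀ t, 0 ≤ t →
    dv t - lap (v t) + leray (advect (u t) (v t) + advect (v t) (u t) + advect (v t) (v t)) = 0
  init : v 0 = v₀

end

end NSTorus

namespace NSTorus

open MeasureTheory Filter Topology

noncomputable section

/-! ### Fourier series of complex functions on the torus -/

section Characters

variable {d : ℕ}

/-! Work in `L²` throughout. The multiplier `smooth s`, with symbol `⟨ξ⟩^{-s}`, maps `L²` onto `H^s`
and is isometric up to the factor `(2π)^{-d/2}`, so every curve in `H^s` is `smooth s` of a curve in
`L²`. Write `v = smooth s V` and `u_ω = smooth s U`. Since `s - 1 > d/2`, the space `H^{s-1}` has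
the algebra property, and `𝔏(a · ∇b)` becomes `smooth (s - 1) (N A B)` with `N` a bounded bilinear
map on `L²` (`exists_bilinear`): the transport term loses exactly one derivative.

The perturbation equation is equivalent to Duhamel's formula `V(t) = e^{tΔ}V₀ - ∫_0^t ⟨D⟩e^{rΔ}
(N(U,V) + N(V,U) + N(V,V))(t - r) dr`. On zero-average fields `⟨D⟩e^{rΔ}` has norm at most a
multiple of `r^{-1/2}e^{-cr}`. This is integrable on the half-line, so the smoothing of the heat
flow pays for the lost derivative (`isKernel_derivHeat`).

For the decay, put `V = e^{-αt}W`. The heat flow is then replaced by `e^{t(Δ+α)}`, which has the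
same kind of bounds because nonzero integer frequencies satisfy `|ξ|² ≥ 1 > α`, while the quadratic
term only gains the harmless factor `e^{-αt}`. Both `u_ω` and `V₀` have size `O(δ)`, so the
right-hand side is a contraction on a small ball of bounded continuous curves
(`exists_mild_solution`), and a bounded `W` means an exponentially decaying `V`.

The integral and differential equations are compared one Fourier coefficient at a time, where each
is a linear ODE with a source (`isPerturbationSolution_of_mild`,
`IsPerturbationSolution.exists_mild`); the zero mode stays zero because the transporting fields have
zero divergence. Uniqueness needs no smallness: in the norm weighted by `e^{-γt}` with `γ` large,
the kernel has as little mass as desired (`mild_unique`). -/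

theorem character_apply (ξ : Fin d → ℤ) (x : Torus d) :
    character ξ x = ∏ j, fourier (T := 2 * Real.pi) (ξ j) (x j) := rfl

theorem character_neg (ξ : Fin d → ℤ) (x : Torus d) :
    character (-ξ) x = starRingEnd ℂ (character ξ x) := by
  simp only [character_apply, Pi.neg_apply, fourier_neg, map_prod]

theorem character_add (ξ η : Fin d → ℤ) (x : Torus d) :
    character (ξ + η) x = character ξ x * character η x := by
  simp only [character_apply, Pi.add_apply, fourier_add, Finset.prod_mul_distrib]

theorem character_zero (x : Torus d) : character (0 : Fin d → ℤ) x = 1 := by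
  simp [character_apply]

theorem norm_character_apply (ξ : Fin d → ℤ) (x : Torus d) : ‖character ξ x‖ = 1 := by
  rw [character_apply, norm_prod]
  exact Finset.prod_eq_one fun j _ => Circle.norm_coe _

theorem character_single (z : Torus d) (i : Fin d) :
    character (Pi.single i 1) z = fourier (T := 2 * Real.pi) 1 (z i) := by
  rw [character_apply, Finset.prod_eq_single i]
  · rw [Pi.single_eq_same]
  · intro j _ hj
    rw [Pi.single_eq_of_ne hj, fourier_zero]
  · intro h
    exact absurd (Finset.mem_univ i) h

/-- The star subalgebra of `C(𝕋^d, ℂ)` generated by the characters. -/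
def characterSubalgebra (d : ℕ) : StarSubalgebra ℂ C(Torus d, ℂ) where
  toSubalgebra := Algebra.adjoin ℂ (Set.range character)
  star_mem' := by
    change Algebra.adjoin ℂ (Set.range character) ≤ star (Algebra.adjoin ℂ (Set.range character))
    refine Algebra.adjoin_le ?_
    rintro _ ⟨n, rfl⟩
    refine Algebra.subset_adjoin ⟨-n, ?_⟩
    ext1 x
    simp only [character_neg, starRingEnd_apply, ContinuousMap.star_apply]

theorem characterSubalgebra_coe :
    (characterSubalgebra d).toSubalgebra.toSubmodule =
      Submodule.span ℂ (Set.range character) := by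
  apply Algebra.adjoin_eq_span_of_subset
  refine .trans (fun x ↦ Submonoid.closure_induction (fun _ ↦ id) ⟨0, ?_⟩ ?_)
    Submodule.subset_span
  · ext z
    simp [character_zero]
  · rintro _ _ _ _ ⟨m, rfl⟩ ⟨n, rfl⟩
    refine ⟨m + n, ?_⟩
    ext z
    simp [character_add]

/-- If two points differ in the `i`-th coordinate, the character of the `i`-th unit frequency
separates them, because `x ↦ e^{ix}` is injective on the circle. -/
theorem characterSubalgebra_separatesPoints : (characterSubalgebra d).SeparatesPoints := by
  intro x y hxy
  rw [Ne, funext_iff, not_forall] at hxy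
  obtain ⟨i, hi⟩ := hxy
  refine ⟨_, ⟨character (Pi.single i 1), Algebra.subset_adjoin ⟨Pi.single i 1, rfl⟩, rfl⟩, ?_⟩
  change character (Pi.single i 1) x ≠ character (Pi.single i 1) y
  rw [character_single, character_single, fourier_one, fourier_one]
  contrapose hi
  rw [Circle.coe_inj] at hi
  exact AddCircle.injective_toCircle Real.two_pi_pos.ne' hi

theorem span_character_closure_eq_top :
    (Submodule.span ℂ (Set.range <| character (d := d))).topologicalClosure = ⊤ := by
  rw [← characterSubalgebra_coe]
  exact congr_arg (Subalgebra.toSubmodule <| StarSubalgebra.toSubalgebra ·)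
    (ContinuousMap.starSubalgebra_topologicalClosure_eq_top_of_separatesPoints _
      characterSubalgebra_separatesPoints)

/-- The character as an element of `L²(𝕋^d, ℂ)`. -/
def characterLp (ξ : Fin d → ℤ) : Lp ℂ 2 (volume : Measure (Torus d)) :=
  ContinuousMap.toLp (E := ℂ) 2 (volume : Measure (Torus d)) ℂ (character ξ)

theorem coeFn_characterLp (ξ : Fin d → ℤ) : characterLp ξ =ᵐ[volume] character ξ :=
  ContinuousMap.coeFn_toLp volume (character ξ)

theorem span_characterLp_closure_eq_top :
    (Submodule.span ℂ (Set.range (characterLp (d := d)))).topologicalClosure = ⊤ := by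
  have h := (ContinuousMap.toLp_denseRange ℂ (volume : Measure (Torus d)) (p := 2) ℂ
    (by simp)).topologicalClosure_map_submodule span_character_closure_eq_top
  rw [Submodule.map_span, ← Set.range_comp] at h
  exact h

/-- The volume `(2π)^d` of the torus. -/
def torusVol (d : ℕ) : ℝ := (2 * Real.pi) ^ d

theorem torusVol_pos (d : ℕ) : 0 < torusVol d := pow_pos Real.two_pi_pos d

theorem integral_fourier (n : ℤ) :
    ∫ x : AddCircle (2 * Real.pi), fourier n x = if n = 0 then ((2 * Real.pi : ℝ) : ℂ) else 0 := by
  have h := (orthonormal_iff_ite.mp (orthonormal_fourier (T := 2 * Real.pi))) 0 n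
  rw [ContinuousMap.inner_toLp, AddCircle.integral_haarAddCircle] at h
  have h2 : (∫ x : AddCircle (2 * Real.pi), fourier n x) =
      ((2 * Real.pi : ℝ) : ℂ) * if (0 : ℤ) = n then 1 else 0 := by
    rw [← h]
    rw [Complex.real_smul, ← mul_assoc, ← Complex.ofReal_mul,
      mul_inv_cancel₀ Real.two_pi_pos.ne']
    simp
  rw [h2]
  by_cases hn : n = 0
  · simp [hn]
  · simp [hn, Ne.symm hn]

theorem integral_character (ξ : Fin d → ℤ) :
    ∫ x : Torus d, character ξ x = if ξ = 0 then (torusVol d : ℂ) else 0 := by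
  simp only [character_apply]
  rw [MeasureTheory.integral_fintype_prod_volume_eq_prod (fun (j : Fin d)
    (y : AddCircle (2 * Real.pi)) => (fourier (ξ j) y : ℂ))]
  simp only [integral_fourier]
  split_ifs with h
  · subst h
    simp [torusVol]
  · obtain ⟨i, hi⟩ := Function.ne_iff.mp h
    exact Finset.prod_eq_zero (Finset.mem_univ i) (if_neg hi)

theorem inner_characterLp (ξ η : Fin d → ℤ) :
    inner ℂ (characterLp ξ) (characterLp η) = if ξ = η then (torusVol d : ℂ) else 0 := by
  unfold characterLp
  simp only [ContinuousMap.inner_toLp, ← character_neg, ← character_add, integral_character]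
  simp only [add_neg_eq_zero, eq_comm]

/-- The normalized characters form an orthonormal family. -/
theorem orthonormal_characterLp :
    Orthonormal ℂ fun ξ : Fin d → ℤ => (((Real.sqrt (torusVol d))⁻¹ : ℝ) : ℂ) • characterLp ξ := by
  rw [orthonormal_iff_ite]
  intro ξ η
  rw [inner_smul_left, inner_smul_right, inner_characterLp]
  split_ifs
  · rw [Complex.conj_ofReal]
    norm_cast
    rw [← mul_assoc, ← mul_inv, Real.mul_self_sqrt (torusVol_pos d).le,
      inv_mul_cancel₀ (torusVol_pos d).ne']
  · simp

/-- The Hilbert basis of normalized characters of `L²(𝕋^d, ℂ)`. -/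
def characterBasis (d : ℕ) : HilbertBasis (Fin d → ℤ) ℂ (Lp ℂ 2 (volume : Measure (Torus d))) :=
  HilbertBasis.mk orthonormal_characterLp (by
    rw [top_le_iff, eq_top_iff, ← span_characterLp_closure_eq_top]
    apply Submodule.topologicalClosure_mono
    rw [Submodule.span_le]
    rintro _ ⟨ξ, rfl⟩
    have hne : (((Real.sqrt (torusVol d))⁻¹ : ℝ) : ℂ) ≠ 0 := by
      have := Real.sqrt_pos.mpr (torusVol_pos d)
      exact_mod_cast (inv_pos.mpr this).ne'
    have : characterLp ξ = (((Real.sqrt (torusVol d))⁻¹ : ℝ) : ℂ)⁻¹ •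
        ((((Real.sqrt (torusVol d))⁻¹ : ℝ) : ℂ) • characterLp ξ) := by
      rw [smul_smul, inv_mul_cancel₀ hne, one_smul]
    rw [SetLike.mem_coe, this]
    exact Submodule.smul_mem _ _ (Submodule.subset_span ⟨ξ, rfl⟩))

theorem characterBasis_apply (ξ : Fin d → ℤ) :
    characterBasis d ξ = (((Real.sqrt (torusVol d))⁻¹ : ℝ) : ℂ) • characterLp ξ := by
  simp [characterBasis]

/-- Fourier coefficient of a complex function. -/
def ccoeff (f : Lp ℂ 2 (volume : Measure (Torus d))) (ξ : Fin d → ℤ) : ℂ :=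
  ((torusVol d : ℝ) : ℂ)⁻¹ * inner ℂ (characterLp ξ) f

theorem ccoeff_eq_integral (f : Lp ℂ 2 (volume : Measure (Torus d))) (ξ : Fin d → ℤ) :
    ccoeff f ξ = ((torusVol d : ℝ) : ℂ)⁻¹ * ∫ x, f x * character (-ξ) x := by
  unfold ccoeff
  rw [L2.inner_def]
  congr 1
  refine integral_congr_ae ?_
  filter_upwards [coeFn_characterLp ξ] with x hx
  rw [hx, character_neg]
  rfl

theorem coeff_apply {n : ℕ} (u : L2 d n) (ξ : Fin d → ℤ) (i : Fin n) :
    coeff u ξ i = ccoeff (compC i u) ξ := coeff_eq_inner u ξ i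

theorem sqrt_vol_mul (z : ℂ) :
    (((Real.sqrt (torusVol d))⁻¹ : ℝ) : ℂ) * ((((Real.sqrt (torusVol d))⁻¹ : ℝ) : ℂ) * z) =
      ((torusVol d : ℝ) : ℂ)⁻¹ * z := by
  rw [← mul_assoc, ← Complex.ofReal_mul, ← mul_inv, Real.mul_self_sqrt (torusVol_pos d).le]
  push_cast
  rfl

theorem hasSum_ccoeff_smul (f : Lp ℂ 2 (volume : Measure (Torus d))) :
    HasSum (fun ξ => ccoeff f ξ • characterLp ξ) f := by
  have h := (characterBasis d).hasSum_repr f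
  simp only [HilbertBasis.repr_apply_apply, characterBasis_apply, inner_smul_left, smul_smul,
    Complex.conj_ofReal] at h
  convert h using 2 with ξ
  -- The basis vectors carry `vol^{-1/2}` twice, in the coefficient and in the vector; `ccoeff`
  -- carries `vol^{-1}` once.
  rw [ccoeff, ← sqrt_vol_mul]
  ring_nf

theorem hasSum_conj_ccoeff_mul (f g : Lp ℂ 2 (volume : Measure (Torus d))) :
    HasSum (fun ξ => starRingEnd ℂ (ccoeff f ξ) * ccoeff g ξ)
      (((torusVol d : ℝ) : ℂ)⁻¹ * inner ℂ f g) := by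
  have h := ((characterBasis d).hasSum_inner_mul_inner f g).mul_left (((torusVol d : ℝ) : ℂ)⁻¹)
  refine h.congr_fun fun ξ => ?_
  rw [characterBasis_apply, inner_smul_left, inner_smul_right, ccoeff, ccoeff, map_mul,
    inner_conj_symm, Complex.conj_ofReal, map_inv₀, Complex.conj_ofReal]
  have e := sqrt_vol_mul (d := d) (inner ℂ f (characterLp ξ) * inner ℂ (characterLp ξ) g)
  linear_combination -((torusVol d : ℂ)⁻¹) * e

/-- **Riesz–Fischer** theorem for complex functions. -/
theorem exists_ccoeff_eq (c : (Fin d → ℤ) → ℂ) (hc : Summable fun ξ => ‖c ξ‖ ^ 2) :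
    ∃ f : Lp ℂ 2 (volume : Measure (Torus d)), ∀ ξ, ccoeff f ξ = c ξ := by
  have hmem : Memℓp (fun ξ => ((Real.sqrt (torusVol d) : ℝ) : ℂ) * c ξ) 2 := by
    rw [memℓp_gen_iff (by simp)]
    simpa [mul_pow] using hc.mul_left _
  refine ⟨(characterBasis d).repr.symm ⟨_, hmem⟩, fun ξ => ?_⟩
  have h := (characterBasis d).repr_apply_apply ((characterBasis d).repr.symm ⟨_, hmem⟩) ξ
  rw [LinearIsometryEquiv.apply_symm_apply, characterBasis_apply, inner_smul_left,
    Complex.conj_ofReal] at h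
  rw [ccoeff, ← sqrt_vol_mul, ← h]
  have := (Real.sqrt_pos.mpr (torusVol_pos d)).ne'
  push_cast
  rw [inv_mul_cancel_left₀]
  exact_mod_cast this

end Characters

/-! ### Fourier coefficients of real vector fields -/

section RealFields

variable {d n : ℕ}

theorem coeFn_compC (i : Fin n) (u : L2 d n) :
    compC i u =ᵐ[volume] fun x => ((u x i : ℝ) : ℂ) :=
  ContinuousLinearMap.coeFn_compLpL (p := 2) (μ := (volume : Measure (Torus d)))
    (Complex.ofRealCLM.comp (EuclideanSpace.proj i : Vec n →L[ℝ] ℝ)) u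

theorem inner_eq_sum_compC (u v : L2 d n) :
    ((inner ℝ u v : ℝ) : ℂ) = ∑ i, inner ℂ (compC i u) (compC i v) := by
  simp only [L2.inner_def]
  rw [← integral_finsetSum _ fun i _ => L2.integrable_inner _ _, ← integral_complex_ofReal]
  refine integral_congr_ae ?_
  have h : ∀ᵐ x : Torus d, ∀ i, compC i u x = ((u x i : ℝ) : ℂ) ∧
      compC i v x = ((v x i : ℝ) : ℂ) := by
    rw [ae_all_iff]
    intro i
    filter_upwards [coeFn_compC i u, coeFn_compC i v] with x h1 h2 using ⟨h1, h2⟩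
  filter_upwards [h] with x hx
  simp only [(hx _).1, (hx _).2, PiLp.inner_apply]
  simp

/-- **Parseval** identity for real fields. -/
theorem hasSum_inner_coeff (u v : L2 d n) :
    HasSum (fun ξ => (inner ℂ (coeff u ξ) (coeff v ξ)).re) ((torusVol d)⁻¹ * inner ℝ u v) := by
  have h := (hasSum_sum (s := Finset.univ) fun i _ =>
    hasSum_conj_ccoeff_mul (compC i u) (compC i v)).mapL Complex.reCLM
  have e : ∀ ξ, (inner ℂ (coeff u ξ) (coeff v ξ)).re =
      Complex.reCLM (∑ i, starRingEnd ℂ (ccoeff (compC i u) ξ) * ccoeff (compC i v) ξ) := by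
    intro ξ
    rw [PiLp.inner_apply, Complex.reCLM_apply]
    congr 1
    refine Finset.sum_congr rfl fun i _ => ?_
    rw [coeff_apply, coeff_apply, RCLike.inner_apply']
  convert h.congr_fun e using 1
  · rw [← Finset.mul_sum, ← inner_eq_sum_compC, Complex.reCLM_apply]
    norm_cast

theorem hasSum_norm_sq_coeff (u : L2 d n) :
    HasSum (fun ξ => ‖coeff u ξ‖ ^ 2) ((torusVol d)⁻¹ * ‖u‖ ^ 2) := by
  have h := hasSum_inner_coeff u u
  rw [real_inner_self_eq_norm_sq] at h
  convert h using 2 with ξ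
  rw [inner_self_eq_norm_sq_to_K]
  norm_cast

theorem coeff_add (u v : L2 d n) (ξ : Fin d → ℤ) : coeff (u + v) ξ = coeff u ξ + coeff v ξ := by
  ext i
  simp [coeff_apply, ccoeff, mul_add, inner_add_right]

theorem coeff_smul (c : ℝ) (u : L2 d n) (ξ : Fin d → ℤ) : coeff (c • u) ξ = c • coeff u ξ := by
  ext i
  have h : compC i (c • u) = (c : ℂ) • compC i u := by
    rw [map_smul]
    rfl
  simp only [coeff_apply, ccoeff, h, inner_smul_right, PiLp.smul_apply, Complex.real_smul]
  ring

theorem norm_coeff_le (u : L2 d n) (ξ : Fin d → ℤ) :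
    ‖coeff u ξ‖ ≤ (Real.sqrt (torusVol d))⁻¹ * ‖u‖ := by
  have h := hasSum_norm_sq_coeff u
  have h1 := h.tsum_eq ▸ h.summable.le_tsum ξ (fun _ _ => by positivity)
  refine abs_le_of_sq_le_sq' ?_ (by positivity) |>.2
  rw [mul_pow, inv_pow, Real.sq_sqrt (torusVol_pos d).le]
  exact h1

/-- The Fourier coefficient as a continuous linear map. -/
def coeffL (ξ : Fin d → ℤ) : L2 d n →L[ℝ] EuclideanSpace ℂ (Fin n) :=
  LinearMap.mkContinuous
    { toFun := fun u => coeff u ξ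
      map_add' := fun u v => coeff_add u v ξ
      map_smul' := fun c u => coeff_smul c u ξ } _ fun u => norm_coeff_le u ξ

theorem coeffL_apply (ξ : Fin d → ℤ) (u : L2 d n) : coeffL ξ u = coeff u ξ := rfl

theorem coeff_zero (ξ : Fin d → ℤ) : coeff (0 : L2 d n) ξ = 0 := (coeffL ξ).map_zero

theorem coeff_sub (u v : L2 d n) (ξ : Fin d → ℤ) : coeff (u - v) ξ = coeff u ξ - coeff v ξ :=
  (coeffL ξ).map_sub u v

theorem coeff_sum {ι : Type*} (s : Finset ι) (u : ι → L2 d n) (ξ : Fin d → ℤ) :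
    coeff (∑ k ∈ s, u k) ξ = ∑ k ∈ s, coeff (u k) ξ := map_sum (coeffL ξ) u s

theorem norm_sq_eq_tsum (u : L2 d n) : ‖u‖ ^ 2 = torusVol d * ∑' ξ, ‖coeff u ξ‖ ^ 2 := by
  rw [(hasSum_norm_sq_coeff u).tsum_eq, mul_inv_cancel_left₀ (torusVol_pos d).ne']

/-- A field is determined by its Fourier coefficients. -/
theorem ext_coeff {u v : L2 d n} (h : ∀ ξ, coeff u ξ = coeff v ξ) : u = v := by
  rw [← sub_eq_zero, ← norm_eq_zero, ← sq_eq_zero_iff, norm_sq_eq_tsum]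
  simp [coeff_sub, h]

/-- The Fourier coefficients of a real field are Hermitian symmetric. -/
theorem coeff_neg_freq (u : L2 d n) (ξ : Fin d → ℤ) (i : Fin n) :
    coeff u (-ξ) i = starRingEnd ℂ (coeff u ξ i) := by
  simp only [coeff, map_mul, ← integral_conj, map_inv₀, Complex.conj_ofReal, ← character_neg]

/-- **Riesz–Fischer** theorem for real fields. -/
theorem exists_coeff_eq (c : (Fin d → ℤ) → EuclideanSpace ℂ (Fin n))
    (hc : Summable fun ξ => ‖c ξ‖ ^ 2) (hsymm : ∀ ξ i, c (-ξ) i = starRingEnd ℂ (c ξ i)) :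
    ∃ u : L2 d n, ∀ ξ, coeff u ξ = c ξ := by
  have h1 : ∀ i : Fin n, Summable fun ξ => ‖c ξ i‖ ^ 2 := fun i =>
    Summable.of_nonneg_of_le (fun _ => by positivity)
      (fun ξ => by gcongr; exact PiLp.norm_apply_le (c ξ) i) hc
  choose f hf using fun i => exists_ccoeff_eq _ (h1 i)
  have hmem : MemLp (fun x : Torus d => (WithLp.toLp 2 fun i => (f i x).re : Vec n)) 2 volume := by
    refine MemLp.of_eval_piLp fun i => ?_
    exact (Lp.memLp (f i)).re
  refine ⟨hmem.toLp _, fun ξ => ?_⟩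
  ext i
  have hint : ∀ ξ, Integrable (fun x => f i x * character ξ x) (volume : Measure (Torus d)) := by
    intro ξ
    refine Integrable.mul_bdd (c := 1) ((Lp.memLp (f i)).integrable (by simp))
      (character ξ).continuous.aestronglyMeasurable ?_
    exact ae_of_all _ fun x => (norm_character_apply ξ x).le
  -- The field is the real part of the complex solution `f`. Half of it comes from `f` at `ξ`, half
  -- from the conjugate of the coefficient at `-ξ`; the symmetry of `c` makes the two halves equal.
  have e1 : ∫ x : Torus d, (((hmem.toLp _ : L2 d n) x i : ℝ) : ℂ) * character (-ξ) x =
      ∫ x : Torus d, ((1 / 2 : ℂ) * (f i x * character (-ξ) x) +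
        (1 / 2 : ℂ) * starRingEnd ℂ (f i x * character ξ x)) := by
    refine integral_congr_ae ?_
    filter_upwards [hmem.coeFn_toLp] with x hx
    rw [hx]
    simp only [map_mul, ← character_neg]
    have := Complex.re_eq_add_conj (f i x)
    rw [this]
    ring
  have e2 : ∀ ξ, ∫ x : Torus d, f i x * character (-ξ) x = (torusVol d : ℂ) * c ξ i := by
    intro ξ
    rw [← hf i ξ, ccoeff_eq_integral, mul_inv_cancel_left₀]
    exact_mod_cast (torusVol_pos d).ne'
  have e3 := e2 (-ξ)
  rw [neg_neg] at e3
  have hint' : Integrable (fun x => starRingEnd ℂ (f i x * character ξ x))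
      (volume : Measure (Torus d)) := (Complex.conjCLE.toContinuousLinearMap.integrable_comp (hint ξ))
  simp only [coeff]
  rw [e1, integral_add ((hint (-ξ)).const_mul _) (hint'.const_mul _),
    integral_const_mul, integral_const_mul, integral_conj, e2, e3, map_mul, Complex.conj_ofReal,
    hsymm, Complex.conj_conj]
  have := (torusVol_pos d).ne'
  change ((torusVol d : ℝ) : ℂ)⁻¹ * _ = _
  have hne : ((torusVol d : ℝ) : ℂ) ≠ 0 := by exact_mod_cast this
  field_simp
  ring

theorem zeroMean_iff (u : L2 d n) : ZeroMean u ↔ coeff u 0 = 0 := by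
  have hint : Integrable u (volume : Measure (Torus d)) := (Lp.memLp u).integrable (by simp)
  have h : ∀ i, coeff u 0 i = ((torusVol d : ℝ) : ℂ)⁻¹ * (((∫ x : Torus d, u x) i : ℝ) : ℂ) := by
    intro i
    simp only [coeff, neg_zero, character_zero, mul_one]
    rw [integral_complex_ofReal]
    congr 2
    exact ((EuclideanSpace.proj i : Vec n →L[ℝ] ℝ).integral_comp_comm hint)
  have hne : ((torusVol d : ℝ) : ℂ)⁻¹ ≠ 0 := inv_ne_zero (by exact_mod_cast (torusVol_pos d).ne')
  constructor
  · intro h0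
    ext i
    rw [h, h0]
    simp
  · intro h0
    unfold ZeroMean
    ext i
    have := h i
    rw [h0] at this
    simpa [hne] using this.symm

end RealFields

/-! ### The weight `⟨ξ⟩` -/

section Bracket

variable {d : ℕ}

/-- `|ξ|²`. -/
def freqSq (ξ : Fin d → ℤ) : ℝ := ∑ j, (ξ j : ℝ) ^ 2

theorem freqSq_nonneg (ξ : Fin d → ℤ) : 0 ≤ freqSq ξ := Finset.sum_nonneg fun _ _ => sq_nonneg _

theorem freqSq_neg (ξ : Fin d → ℤ) : freqSq (-ξ) = freqSq ξ := by simp [freqSq]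

/-- The spectral gap of the Laplacian on zero-average functions: the source of every decay rate
below 1. -/
theorem one_le_freqSq {ξ : Fin d → ℤ} (h : ξ ≠ 0) : 1 ≤ freqSq ξ := by
  obtain ⟨i, hi⟩ := Function.ne_iff.mp h
  have h1 : (1 : ℝ) ≤ (ξ i : ℝ) ^ 2 := by
    have : (1 : ℤ) ≤ ξ i ^ 2 := by
      have : 0 < ξ i ^ 2 := by
        have : ξ i ≠ 0 := hi
        positivity
      omega
    exact_mod_cast this
  exact h1.trans (Finset.single_le_sum (f := fun j => (ξ j : ℝ) ^ 2) (fun _ _ => sq_nonneg _)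
    (Finset.mem_univ i))

theorem bracket_eq (ξ : Fin d → ℤ) : bracket ξ = max 1 (Real.sqrt (freqSq ξ)) := rfl

theorem one_le_bracket (ξ : Fin d → ℤ) : 1 ≤ bracket ξ := le_max_left _ _

theorem bracket_pos (ξ : Fin d → ℤ) : 0 < bracket ξ := zero_lt_one.trans_le (one_le_bracket ξ)

theorem bracket_neg (ξ : Fin d → ℤ) : bracket (-ξ) = bracket ξ := by
  rw [bracket_eq, bracket_eq, freqSq_neg]

theorem bracket_sq_of_ne {ξ : Fin d → ℤ} (h : ξ ≠ 0) : bracket ξ ^ 2 = freqSq ξ := by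
  rw [bracket_eq, max_eq_right, Real.sq_sqrt (freqSq_nonneg ξ)]
  exact Real.one_le_sqrt.mpr (one_le_freqSq h)

theorem sqrt_freqSq_le_bracket (ξ : Fin d → ℤ) : Real.sqrt (freqSq ξ) ≤ bracket ξ :=
  le_max_right _ _

theorem freqSq_le_bracket_sq (ξ : Fin d → ℤ) : freqSq ξ ≤ bracket ξ ^ 2 := by
  have := sqrt_freqSq_le_bracket ξ
  rwa [Real.sqrt_le_left (bracket_pos ξ).le] at this

theorem abs_apply_le_bracket (ξ : Fin d → ℤ) (j : Fin d) : |(ξ j : ℝ)| ≤ bracket ξ := by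
  refine le_trans ?_ (sqrt_freqSq_le_bracket ξ)
  refine Real.le_sqrt_of_sq_le ?_
  rw [sq_abs]
  exact Finset.single_le_sum (f := fun j => (ξ j : ℝ) ^ 2) (fun _ _ => sq_nonneg _)
    (Finset.mem_univ j)

theorem sqrt_freqSq_eq_norm (ξ : Fin d → ℤ) :
    Real.sqrt (freqSq ξ) = ‖(WithLp.toLp 2 fun j => (ξ j : ℝ) : EuclideanSpace ℝ (Fin d))‖ := by
  rw [EuclideanSpace.norm_eq]
  simp [freqSq]

theorem bracket_add_le (ξ η : Fin d → ℤ) : bracket (ξ + η) ≤ bracket ξ + bracket η := by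
  rw [bracket_eq (ξ + η)]
  refine max_le ?_ ?_
  · linarith [one_le_bracket ξ, one_le_bracket η]
  · refine le_trans ?_ (add_le_add (sqrt_freqSq_le_bracket ξ) (sqrt_freqSq_le_bracket η))
    simp only [sqrt_freqSq_eq_norm]
    refine le_trans (le_of_eq ?_) (norm_add_le _ _)
    congr 1
    ext j
    simp

end Bracket

/-! ### Fourier multipliers and the Leray projector -/

section Multiplier

variable {d n : ℕ}

/-- The even bounded functions of the frequency. -/
def IsSymbol (m : (Fin d → ℤ) → ℝ) : Prop :=
  (∀ ξ, m (-ξ) = m ξ) ∧ ∃ M : ℝ, ∀ ξ, |m ξ| ≤ M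

/-- Evenness of a real symbol preserves the Hermitian symmetry of the coefficients, so the resulting
field is again real. -/
theorem exists_mult {m : (Fin d → ℤ) → ℝ} (h : IsSymbol m) (u : L2 d n) :
    ∃ w : L2 d n, ∀ ξ, coeff w ξ = m ξ • coeff u ξ := by
  obtain ⟨h1, M, hM⟩ := h
  refine exists_coeff_eq _ ?_ fun ξ i => ?_
  · refine Summable.of_nonneg_of_le (fun _ => by positivity) (fun ξ => ?_)
      ((hasSum_norm_sq_coeff u).summable.mul_left (M ^ 2))
    rw [norm_smul, mul_pow, Real.norm_eq_abs]
    gcongr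
    exact hM ξ
  · simp only [h1, PiLp.smul_apply, coeff_neg_freq, Complex.real_smul, map_mul, Complex.conj_ofReal]

theorem norm_le_of_coeff_le {u w : L2 d n} {M : ℝ} (hM : 0 ≤ M)
    (h : ∀ ξ, ‖coeff w ξ‖ ≤ M * ‖coeff u ξ‖) : ‖w‖ ≤ M * ‖u‖ := by
  refine abs_le_of_sq_le_sq' ?_ (by positivity) |>.2
  rw [mul_pow, norm_sq_eq_tsum, norm_sq_eq_tsum, mul_left_comm]
  refine mul_le_mul_of_nonneg_left ?_ (torusVol_pos d).le
  rw [← tsum_mul_left]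
  refine Summable.tsum_le_tsum (fun ξ => ?_) (hasSum_norm_sq_coeff w).summable
    ((hasSum_norm_sq_coeff u).summable.mul_left _)
  rw [← mul_pow]
  gcongr
  exact h ξ

open Classical in
/-- The Fourier multiplier with the symbol `m`. -/
def mult (m : (Fin d → ℤ) → ℝ) : L2 d n →L[ℝ] L2 d n :=
  if h : IsSymbol m then
    LinearMap.mkContinuousOfExistsBound
      { toFun := fun u => (exists_mult h u).choose
        map_add' := fun u v => ext_coeff fun ξ => by
          rw [coeff_add, (exists_mult h _).choose_spec, (exists_mult h _).choose_spec,
            (exists_mult h _).choose_spec, coeff_add, smul_add]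
        map_smul' := fun c u => ext_coeff fun ξ => by
          rw [RingHom.id_apply, coeff_smul, (exists_mult h _).choose_spec,
            (exists_mult h _).choose_spec, coeff_smul, smul_comm] }
      ⟨h.2.choose, fun u => norm_le_of_coeff_le ((abs_nonneg _).trans (h.2.choose_spec 0))
        fun ξ => by
          change ‖coeff (exists_mult h u).choose ξ‖ ≤ _
          rw [(exists_mult h _).choose_spec, norm_smul]
          gcongr
          exact h.2.choose_spec ξ⟩
  else 0

theorem coeff_mult {m : (Fin d → ℤ) → ℝ} (h : IsSymbol m) (u : L2 d n) (ξ : Fin d → ℤ) :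
    coeff (mult m u) ξ = m ξ • coeff u ξ := by
  rw [mult, dif_pos h]
  exact (exists_mult h u).choose_spec ξ

theorem norm_mult_le {m : (Fin d → ℤ) → ℝ} (h : IsSymbol m) {M : ℝ} (hM0 : 0 ≤ M)
    (hM : ∀ ξ, |m ξ| ≤ M) : ‖(mult m : L2 d n →L[ℝ] L2 d n)‖ ≤ M := by
  refine ContinuousLinearMap.opNorm_le_bound _ hM0 fun u => norm_le_of_coeff_le hM0 fun ξ => ?_
  rw [coeff_mult h, norm_smul]
  gcongr
  exact hM ξ

/-- By Parseval the squared error is a sum over frequencies, and dominated convergence applies with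
the bound `(M + M')² |û(ξ)|²`. The convergence is strong, not in operator norm, which is all that a
heat flow offers at time 0. -/
theorem tendsto_mult {ι : Type*} {l : Filter ι} {m : ι → (Fin d → ℤ) → ℝ}
    {m' : (Fin d → ℤ) → ℝ} (h : ∀ᶠ k in l, IsSymbol (m k)) (h' : IsSymbol m') {M : ℝ}
    (hM : ∀ᶠ k in l, ∀ ξ, |m k ξ| ≤ M) (hlim : ∀ ξ, Tendsto (fun k => m k ξ) l (𝓝 (m' ξ)))
    (u : L2 d n) : Tendsto (fun k => mult (m k) u) l (𝓝 (mult m' u)) := by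
  obtain ⟨-, M', hM'⟩ := id h'
  rw [tendsto_iff_norm_sub_tendsto_zero]
  have h1 : Tendsto (fun k => torusVol d * ∑' ξ, |m k ξ - m' ξ| ^ 2 * ‖coeff u ξ‖ ^ 2) l
      (𝓝 (torusVol d * ∑' ξ : Fin d → ℤ, (0 : ℝ))) := by
    refine Tendsto.const_mul _ ?_
    refine tendsto_tsum_of_dominated_convergence
      (bound := fun ξ => (M + M') ^ 2 * ‖coeff u ξ‖ ^ 2)
      ((hasSum_norm_sq_coeff u).summable.mul_left _) (fun ξ => ?_) ?_
    · have := ((((hlim ξ).sub_const (m' ξ)).abs).pow 2).mul_const (‖coeff u ξ‖ ^ 2)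
      simpa using this
    · filter_upwards [hM] with k hk ξ
      rw [Real.norm_of_nonneg (by positivity)]
      gcongr
      exact (abs_sub _ _).trans (add_le_add (hk ξ) (hM' ξ))
  have h2 := h1.sqrt
  simp only [tsum_zero, mul_zero, Real.sqrt_zero] at h2
  refine h2.congr' ?_
  filter_upwards [h] with k hk
  rw [← Real.sqrt_sq (norm_nonneg (mult (m k) u - mult m' u)), norm_sq_eq_tsum]
  congr 3
  ext ξ
  rw [coeff_sub, coeff_mult hk, coeff_mult h', ← sub_smul, norm_smul, mul_pow, Real.norm_eq_abs]

theorem inner_mult_left {m : (Fin d → ℤ) → ℝ} (h : IsSymbol m) (u v : L2 d n) :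
    inner ℝ (mult m u) v = inner ℝ u (mult m v) := by
  have h1 := hasSum_inner_coeff (mult m u) v
  have h2 := hasSum_inner_coeff u (mult m v)
  have h3 : ∀ ξ, (inner ℂ (coeff (mult m u) ξ) (coeff v ξ)).re =
      (inner ℂ (coeff u ξ) (coeff (mult m v) ξ)).re := by
    intro ξ
    rw [coeff_mult h, coeff_mult h, ← Complex.coe_smul, ← Complex.coe_smul, inner_smul_left,
      inner_smul_right, Complex.conj_ofReal]
  have h4 := (h1.congr_fun fun ξ => (h3 ξ).symm).unique h2
  exact mul_left_cancel₀ (inv_ne_zero (torusVol_pos d).ne') h4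

theorem mult_mem_divFree {m : (Fin d → ℤ) → ℝ} (h : IsSymbol m) {u : L2 d d}
    (hu : u ∈ divFree d) : mult m u ∈ divFree d := by
  intro ξ
  simp only [coeff_mult h, PiLp.smul_apply, Complex.real_smul]
  simp only [mul_left_comm, ← Finset.mul_sum]
  rw [hu ξ, mul_zero]

theorem leray_mem (u : L2 d d) : leray u ∈ divFree d := Submodule.starProjection_apply_mem _ u

theorem leray_eq_self {u : L2 d d} (hu : u ∈ divFree d) : leray u = u :=
  Submodule.starProjection_eq_self_iff.mpr hu

/-- A real even multiplier preserves `divFree` and is symmetric, so it preserves the orthogonal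
complement too; hence it commutes with the projector. The matrix symbol of `leray` is never
computed. -/
theorem leray_mult {m : (Fin d → ℤ) → ℝ} (h : IsSymbol m) (u : L2 d d) :
    leray (mult m u) = mult m (leray u) := by
  refine Submodule.eq_starProjection_of_mem_of_inner_eq_zero (mult_mem_divFree h (leray_mem u))
    fun w hw => ?_
  rw [← map_sub, inner_mult_left h]
  exact Submodule.starProjection_inner_eq_zero u _ (mult_mem_divFree h hw)

end Multiplier

/-! ### Sobolev spaces as images of `L²` -/

section Sobolev

variable {d n : ℕ}

theorem isSymbol_bracket_rpow {s : ℝ} (hs : 0 ≤ s) :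
    IsSymbol fun ξ : Fin d → ℤ => bracket ξ ^ (-s) := by
  refine ⟨fun ξ => by simp only [bracket_neg], 1, fun ξ => ?_⟩
  rw [abs_of_nonneg (Real.rpow_nonneg (bracket_pos ξ).le _)]
  exact Real.rpow_le_one_of_one_le_of_nonpos (one_le_bracket ξ) (by linarith)

/-- The smoothing operator with symbol `⟨ξ⟩^{-s}`, an isomorphism of `L²` onto `H^s`. -/
def smooth (s : ℝ) : L2 d n →L[ℝ] L2 d n := mult fun ξ => bracket ξ ^ (-s)

theorem coeff_smooth {s : ℝ} (hs : 0 ≤ s) (V : L2 d n) (ξ : Fin d → ℤ) :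
    coeff (smooth s V) ξ = bracket ξ ^ (-s) • coeff V ξ := coeff_mult (isSymbol_bracket_rpow hs) V ξ

theorem norm_smooth_apply_le {s : ℝ} (hs : 0 ≤ s) (V : L2 d n) : ‖smooth s V‖ ≤ ‖V‖ := by
  refine (norm_le_of_coeff_le (u := V) zero_le_one fun ξ => ?_).trans_eq (one_mul _)
  rw [coeff_smooth hs, norm_smul, Real.norm_of_nonneg (Real.rpow_nonneg (bracket_pos ξ).le _)]
  gcongr
  exact Real.rpow_le_one_of_one_le_of_nonpos (one_le_bracket ξ) (by linarith)

/-- The two weights cancel term by term, which makes `smooth s` an isometry onto `H^s` up to the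
normalization of Parseval. -/
theorem bracket_rpow_mul_coeff_smooth {s : ℝ} (hs : 0 ≤ s) (V : L2 d n) (ξ : Fin d → ℤ) :
    bracket ξ ^ (2 * s) * ‖coeff (smooth s V) ξ‖ ^ 2 = ‖coeff V ξ‖ ^ 2 := by
  rw [coeff_smooth hs, norm_smul, Real.norm_of_nonneg (Real.rpow_nonneg (bracket_pos ξ).le _),
    mul_pow, ← Real.rpow_mul_natCast (bracket_pos ξ).le, ← mul_assoc,
    ← Real.rpow_add (bracket_pos ξ)]
  rw [show 2 * s + -s * (2 : ℕ) = 0 by push_cast; ring, Real.rpow_zero, one_mul]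

theorem memHs_smooth {s : ℝ} (hs : 0 ≤ s) (V : L2 d n) : MemHs s (smooth s V) := by
  unfold MemHs
  simp only [bracket_rpow_mul_coeff_smooth hs]
  exact (hasSum_norm_sq_coeff V).summable

theorem hsNorm_smooth {s : ℝ} (hs : 0 ≤ s) (V : L2 d n) :
    hsNorm s (smooth s V) = (Real.sqrt (torusVol d))⁻¹ * ‖V‖ := by
  unfold hsNorm
  simp only [bracket_rpow_mul_coeff_smooth hs]
  rw [(hasSum_norm_sq_coeff V).tsum_eq, Real.sqrt_mul (inv_nonneg.mpr (torusVol_pos d).le),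
    Real.sqrt_inv, Real.sqrt_sq (norm_nonneg _)]

theorem MemHs.exists_smooth {s : ℝ} (hs : 0 ≤ s) {v : L2 d n} (hv : MemHs s v) :
    ∃ V : L2 d n, smooth s V = v := by
  have h1 : ∀ ξ, ‖bracket ξ ^ s • coeff v ξ‖ ^ 2 = bracket ξ ^ (2 * s) * ‖coeff v ξ‖ ^ 2 := by
    intro ξ
    rw [norm_smul, Real.norm_of_nonneg (Real.rpow_nonneg (bracket_pos ξ).le _), mul_pow,
      ← Real.rpow_mul_natCast (bracket_pos ξ).le, mul_comm s]
    rfl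
  obtain ⟨V, hV⟩ := exists_coeff_eq (fun ξ => bracket ξ ^ s • coeff v ξ)
    (by simp only [h1]; exact hv) (fun ξ i => by
      simp only [bracket_neg, PiLp.smul_apply, coeff_neg_freq, Complex.real_smul, map_mul,
        Complex.conj_ofReal])
  refine ⟨V, ext_coeff fun ξ => ?_⟩
  rw [coeff_smooth hs, hV, smul_smul, ← Real.rpow_add (bracket_pos ξ), neg_add_cancel,
    Real.rpow_zero, one_smul]

theorem smooth_injective {s : ℝ} (hs : 0 ≤ s) :
    Function.Injective (smooth s : L2 d n → L2 d n) := by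
  intro V W h
  refine ext_coeff fun ξ => ?_
  have h1 := congrArg (fun u => coeff u ξ) h
  simp only [coeff_smooth hs] at h1
  exact smul_right_injective _ (Real.rpow_pos_of_pos (bracket_pos ξ) _).ne' h1

theorem smooth_smooth {r s : ℝ} (hr : 0 ≤ r) (hs : 0 ≤ s) (V : L2 d n) :
    smooth r (smooth s V) = smooth (r + s) V := by
  refine ext_coeff fun ξ => ?_
  rw [coeff_smooth hr, coeff_smooth hs, coeff_smooth (add_nonneg hr hs), smul_smul,
    ← Real.rpow_add (bracket_pos ξ)]
  congr 2
  ring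

theorem leray_smooth {s : ℝ} (hs : 0 ≤ s) (V : L2 d d) : leray (smooth s V) = smooth s (leray V) :=
  leray_mult (isSymbol_bracket_rpow hs) V

/-- For the direct implication, `smooth s V` is fixed by `leray`; commuting and using injectivity,
so is `V`. -/
theorem smooth_mem_divFree_iff {s : ℝ} (hs : 0 ≤ s) (V : L2 d d) :
    smooth s V ∈ divFree d ↔ V ∈ divFree d := by
  refine ⟨fun h => ?_, mult_mem_divFree (isSymbol_bracket_rpow hs)⟩
  have h1 := leray_eq_self h
  rw [leray_smooth hs] at h1
  rw [← smooth_injective hs h1]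
  exact leray_mem V

theorem MemHs.mono {r s : ℝ} (hrs : r ≤ s) {u : L2 d n} (h : MemHs s u) : MemHs r u := by
  refine Summable.of_nonneg_of_le (fun ξ => ?_) (fun ξ => ?_) h
  · exact mul_nonneg (Real.rpow_nonneg (bracket_pos ξ).le _) (by positivity)
  · gcongr
    exact one_le_bracket ξ

theorem MemHs.sub {s : ℝ} (hs : 0 ≤ s) {u v : L2 d n} (hu : MemHs s u) (hv : MemHs s v) :
    MemHs s (u - v) := by
  obtain ⟨U, rfl⟩ := hu.exists_smooth hs
  obtain ⟨V, rfl⟩ := hv.exists_smooth hs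
  rw [← map_sub]
  exact memHs_smooth hs _

theorem MemHs.smul {s : ℝ} (hs : 0 ≤ s) (c : ℝ) {u : L2 d n} (hu : MemHs s u) :
    MemHs s (c • u) := by
  obtain ⟨U, rfl⟩ := hu.exists_smooth hs
  rw [← map_smul]
  exact memHs_smooth hs _

theorem norm_coeff_le_hsNorm {s : ℝ} (hs : 0 ≤ s) {u : L2 d n} (hu : MemHs s u)
    (ξ : Fin d → ℤ) : ‖coeff u ξ‖ ≤ hsNorm s u := by
  obtain ⟨U, rfl⟩ := hu.exists_smooth hs
  rw [hsNorm_smooth hs, coeff_smooth hs, norm_smul,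
    Real.norm_of_nonneg (Real.rpow_nonneg (bracket_pos ξ).le _)]
  refine le_trans ?_ (norm_coeff_le U ξ)
  refine mul_le_of_le_one_left (norm_nonneg _) ?_
  exact Real.rpow_le_one_of_one_le_of_nonpos (one_le_bracket ξ) (by linarith)

theorem exists_isPartial (j : Fin d) {u : L2 d n} (hu : MemHs 1 u) : ∃ g, IsPartial j u g := by
  refine exists_coeff_eq _ (Summable.of_nonneg_of_le (fun _ => by positivity) (fun ξ => ?_) hu)
    fun ξ i => ?_
  · rw [norm_smul, mul_pow, norm_mul, Complex.norm_I, one_mul, Complex.norm_intCast, mul_one,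
      Real.rpow_two]
    gcongr
    exact abs_apply_le_bracket ξ j
  · simp [coeff_neg_freq]

theorem coeff_partialD (j : Fin d) {u : L2 d n} (hu : MemHs 1 u) (ξ : Fin d → ℤ) :
    coeff (partialD j u) ξ = (Complex.I * (ξ j : ℂ)) • coeff u ξ := by
  have h := exists_isPartial j hu
  rw [partialD, dif_pos h]
  exact h.choose_spec ξ

theorem memHs_one_partialD (j : Fin d) {u : L2 d n} (hu : MemHs 2 u) : MemHs 1 (partialD j u) := by
  refine Summable.of_nonneg_of_le (fun ξ => ?_) (fun ξ => ?_) hu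
  · exact mul_nonneg (Real.rpow_nonneg (bracket_pos ξ).le _) (by positivity)
  · rw [coeff_partialD j (hu.mono (by norm_num)), norm_smul, mul_pow, norm_mul, Complex.norm_I,
      one_mul, Complex.norm_intCast, ← mul_assoc]
    gcongr
    have : bracket ξ ^ (2 * 2 : ℝ) = bracket ξ ^ (2 * 1 : ℝ) * bracket ξ ^ 2 := by
      rw [← Real.rpow_two, ← Real.rpow_add (bracket_pos ξ)]
      norm_num
    rw [this]
    gcongr
    · exact Real.rpow_nonneg (bracket_pos ξ).le _
    · exact abs_apply_le_bracket ξ j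

/-- Membership in `H²` ensures that neither of the two nested derivatives takes the default value 0
of `partialD`. -/
theorem coeff_lap {u : L2 d n} (hu : MemHs 2 u) (ξ : Fin d → ℤ) :
    coeff (lap u) ξ = -freqSq ξ • coeff u ξ := by
  rw [lap, coeff_sum]
  simp only [coeff_partialD _ (memHs_one_partialD _ hu), coeff_partialD _ (hu.mono one_le_two),
    smul_smul]
  rw [← Finset.sum_smul, ← Complex.coe_smul]
  congr 1
  rw [freqSq]
  push_cast
  rw [← Finset.sum_neg_distrib]
  refine Finset.sum_congr rfl fun j _ => ?_
  linear_combination ((ξ j : ℂ) ^ 2) * Complex.I_sq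

end Sobolev

/-! ### Weighted convolution estimates on the frequency lattice -/

section Summability

variable {d : ℕ}

theorem summable_bracket_rpow {r : ℝ} (hr : (d : ℝ) < r) :
    Summable fun ξ : Fin d → ℤ => bracket ξ ^ (-r) := by
  let b := (EuclideanSpace.basisFun (Fin d) ℝ).toBasis
  let L := Submodule.span ℤ (Set.range b)
  have hL := ZLattice.summable_norm_rpow L (-r) (by
    rw [ZLattice.rank ℝ L]
    simpa using hr)
  have hmem : ∀ ξ : Fin d → ℤ,
      (WithLp.toLp 2 fun j => (ξ j : ℝ) : EuclideanSpace ℝ (Fin d)) ∈ L := by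
    intro ξ
    have : (WithLp.toLp 2 fun j => (ξ j : ℝ) : EuclideanSpace ℝ (Fin d)) = ∑ j, ξ j • b j := by
      ext i
      simp [b, Finset.sum_apply, Pi.single_apply]
    rw [this]
    exact Submodule.sum_mem _ fun j _ => Submodule.smul_mem _ _ (Submodule.subset_span ⟨j, rfl⟩)
  have hinj : Function.Injective fun ξ : Fin d → ℤ => (⟨_, hmem ξ⟩ : L) := by
    intro ξ η h
    ext j
    have := congrArg (fun z : L => (z : EuclideanSpace ℝ (Fin d)) j) h
    simpa using this
  have h1 := hL.comp_injective hinj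
  -- The lattice sum has `|ξ|` where `⟨ξ⟩` is wanted; the two differ only at the origin, which this
  -- one-point sum covers.
  have h2 : Summable fun ξ : Fin d → ℤ => if ξ = 0 then (1 : ℝ) else 0 :=
    summable_of_ne_finset_zero (s := {0}) (by intro ξ hξ; simpa using hξ)
  refine Summable.of_nonneg_of_le (fun ξ => Real.rpow_nonneg (bracket_pos ξ).le _) (fun ξ => ?_)
    (h1.add h2)
  simp only [Function.comp, Submodule.coe_norm, ← sqrt_freqSq_eq_norm]
  by_cases h : ξ = 0
  · rw [if_pos h]
    have : bracket ξ ^ (-r) ≤ 1 := Real.rpow_le_one_of_one_le_of_nonpos (one_le_bracket ξ) (by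
      have : (0 : ℝ) ≤ d := by positivity
      linarith)
    have := Real.rpow_nonneg (Real.sqrt_nonneg (freqSq ξ)) (-r)
    linarith
  · rw [if_neg h, add_zero, ← bracket_sq_of_ne h, Real.sqrt_sq (bracket_pos ξ).le]

theorem tsum_mul_sq_le {ι : Type*} {f g : ι → ℝ} (hf : ∀ i, 0 ≤ f i) (hg : ∀ i, 0 ≤ g i)
    (hf2 : Summable fun i => f i ^ 2) (hg2 : Summable fun i => g i ^ 2) :
    Summable (fun i => f i * g i) ∧
      (∑' i, f i * g i) ^ 2 ≤ (∑' i, f i ^ 2) * ∑' i, g i ^ 2 := by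
  have hpq : Real.HolderConjugate 2 2 := Real.HolderConjugate.two_two
  simp only [← Real.rpow_two] at hf2 hg2 ⊢
  have h1 := Real.summable_mul_of_Lp_Lq_of_nonneg hpq hf hg hf2 hg2
  have h2 := Real.inner_le_Lp_mul_Lq_tsum_of_nonneg hpq hf hg hf2 hg2
  refine ⟨h1, ?_⟩
  have hF : 0 ≤ ∑' i, f i ^ (2 : ℝ) := tsum_nonneg fun i => Real.rpow_nonneg (hf i) _
  have hG : 0 ≤ ∑' i, g i ^ (2 : ℝ) := tsum_nonneg fun i => Real.rpow_nonneg (hg i) _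
  rw [← Real.sqrt_eq_rpow, ← Real.sqrt_eq_rpow, ← Real.sqrt_mul hF] at h2
  rw [Real.rpow_two, ← Real.sq_sqrt (mul_nonneg hF hG)]
  gcongr
  exact tsum_nonneg fun i => mul_nonneg (hf i) (hg i)

/-- The shear `(x, y) ↦ (x - y, y)` is a bijection of `G × G`, and it turns the double sum of the
convolution into a product of sums. -/
theorem hasSum_convolution {G : Type*} [AddCommGroup G] {f g : G → ℝ} (hf0 : ∀ x, 0 ≤ f x)
    (hg0 : ∀ x, 0 ≤ g x) (hf : Summable f) (hg : Summable g) :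
    (∀ x, Summable fun y => f (x - y) * g y) ∧
      HasSum (fun x => ∑' y, f (x - y) * g y) ((∑' x, f x) * ∑' x, g x) := by
  have h := hf.hasSum.mul hg.hasSum (hf.mul_of_nonneg hg hf0 hg0)
  let e : G × G ≃ G × G :=
    { toFun := fun p => (p.1 - p.2, p.2)
      invFun := fun p => (p.1 + p.2, p.2)
      left_inv := fun p => by simp
      right_inv := fun p => by simp }
  have h1 : HasSum (fun p : G × G => f (p.1 - p.2) * g p.2) ((∑' x, f x) * ∑' x, g x) :=
    e.hasSum_iff.mpr h
  have h2 : ∀ x, Summable fun y => f (x - y) * g y := fun x => h1.summable.prod_factor x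
  exact ⟨h2, h1.prod_fiberwise fun x => (h2 x).hasSum⟩

/-- Exchanging `η` and `ξ - η`, let `η` be the larger frequency. Then `⟨ξ⟩ ≤ 2⟨η⟩`, so `⟨ξ⟩^r` is
absorbed by `⟨η⟩^{-r}` and only the weight of the smaller frequency remains. -/
theorem bracket_weight_le {r : ℝ} (hr : 0 ≤ r) (ξ η : Fin d → ℤ) :
    (bracket ξ ^ r * (bracket (ξ - η) ^ (-r) * bracket η ^ (-r))) ^ 2 ≤
      4 ^ r * (bracket (ξ - η) ^ (-(2 * r)) + bracket η ^ (-(2 * r))) := by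
  wlog h : bracket (ξ - η) ≤ bracket η generalizing η
  · have := this (ξ - η) (by rw [sub_sub_cancel]; exact (not_le.mp h).le)
    rw [sub_sub_cancel, mul_comm (bracket η ^ (-r)), add_comm] at this
    exact this
  have h0 := bracket_pos (ξ - η)
  have h1 := bracket_pos η
  have h2 : bracket ξ ≤ 2 * bracket η := by
    have := bracket_add_le (ξ - η) η
    rw [sub_add_cancel] at this
    linarith
  have h3 : bracket ξ ^ r * (bracket (ξ - η) ^ (-r) * bracket η ^ (-r)) ≤
      2 ^ r * bracket (ξ - η) ^ (-r) := by
    have h4 : bracket ξ ^ r ≤ 2 ^ r * bracket η ^ r := by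
      rw [← Real.mul_rpow two_pos.le h1.le]
      exact Real.rpow_le_rpow (bracket_pos ξ).le h2 hr
    calc bracket ξ ^ r * (bracket (ξ - η) ^ (-r) * bracket η ^ (-r))
        ≤ (2 ^ r * bracket η ^ r) * (bracket (ξ - η) ^ (-r) * bracket η ^ (-r)) := by
          gcongr
      _ = 2 ^ r * bracket (ξ - η) ^ (-r) * (bracket η ^ r * bracket η ^ (-r)) := by ring
      _ = 2 ^ r * bracket (ξ - η) ^ (-r) := by
          rw [← Real.rpow_add h1, add_neg_cancel, Real.rpow_zero, mul_one]
  calc _ ≤ (2 ^ r * bracket (ξ - η) ^ (-r)) ^ 2 := by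
        have := bracket_pos ξ
        gcongr
    _ = 4 ^ r * bracket (ξ - η) ^ (-(2 * r)) := by
        rw [mul_pow, ← Real.rpow_mul_natCast two_pos.le, ← Real.rpow_mul_natCast h0.le, mul_comm r,
          Real.rpow_mul two_pos.le]
        congr 2
        · norm_num
        · push_cast
          ring
    _ ≤ _ := by
        gcongr
        exact le_add_of_nonneg_right (by positivity)

/-- The estimate behind the algebra property of the Sobolev space `H^r`, `r > d / 2`. -/
theorem convolution_bracket_le {r : ℝ} (hr : (d : ℝ) < 2 * r) {α β : (Fin d → ℤ) → ℝ}
    (hα : ∀ ξ, 0 ≤ α ξ) (hβ : ∀ ξ, 0 ≤ β ξ) (hα2 : Summable fun ξ => α ξ ^ 2)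
    (hβ2 : Summable fun ξ => β ξ ^ 2) :
    (∀ ξ, Summable fun η => bracket (ξ - η) ^ (-r) * α (ξ - η) * (bracket η ^ (-r) * β η)) ∧
    Summable (fun ξ => (bracket ξ ^ r *
      ∑' η, bracket (ξ - η) ^ (-r) * α (ξ - η) * (bracket η ^ (-r) * β η)) ^ 2) ∧
    ∑' ξ, (bracket ξ ^ r *
      ∑' η, bracket (ξ - η) ^ (-r) * α (ξ - η) * (bracket η ^ (-r) * β η)) ^ 2 ≤
      (4 ^ r * (2 * ∑' ξ : Fin d → ℤ, bracket ξ ^ (-(2 * r)))) *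
        ((∑' ξ, α ξ ^ 2) * ∑' ξ, β ξ ^ 2) := by
  have hr0 : 0 ≤ r := by
    have : (0 : ℝ) ≤ d := by positivity
    linarith
  have hS := summable_bracket_rpow hr
  obtain ⟨hc1, hc2⟩ := hasSum_convolution (fun ξ => sq_nonneg (α ξ)) (fun ξ => sq_nonneg (β ξ))
    hα2 hβ2
  have hw : ∀ ξ : Fin d → ℤ, HasSum (fun η : Fin d → ℤ =>
      4 ^ r * (bracket (ξ - η) ^ (-(2 * r)) + bracket η ^ (-(2 * r))))
      (4 ^ r * (2 * ∑' ξ : Fin d → ℤ, bracket ξ ^ (-(2 * r)))) := by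
    intro ξ
    rw [two_mul (∑' ξ : Fin d → ℤ, bracket ξ ^ (-(2 * r)))]
    exact ((((Equiv.subLeft ξ).hasSum_iff).mpr hS.hasSum).add hS.hasSum).mul_left _
  have hw2 : ∀ ξ : Fin d → ℤ, Summable fun η : Fin d → ℤ =>
      (bracket ξ ^ r * (bracket (ξ - η) ^ (-r) * bracket η ^ (-r))) ^ 2 := fun ξ =>
    Summable.of_nonneg_of_le (fun _ => sq_nonneg _) (bracket_weight_le hr0 ξ) (hw ξ).summable
  -- Cauchy–Schwarz in `η`, with the weights on one side and `α(ξ - η)β(η)` on the other. The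
  -- squared weights sum to a bound uniform in `ξ` since `2r > d`; what is left is a convolution of
  -- `α²` with `β²`, summable in `ξ`.
  have hcs := fun ξ : Fin d → ℤ => tsum_mul_sq_le
    (f := fun η : Fin d → ℤ => bracket ξ ^ r * (bracket (ξ - η) ^ (-r) * bracket η ^ (-r)))
    (g := fun η => α (ξ - η) * β η)
    (fun η => mul_nonneg (Real.rpow_nonneg (bracket_pos ξ).le _)
      (mul_nonneg (Real.rpow_nonneg (bracket_pos _).le _) (Real.rpow_nonneg (bracket_pos η).le _)))
    (fun η => mul_nonneg (hα _) (hβ _)) (hw2 ξ) (by simpa only [mul_pow] using hc1 ξ)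
  have hre : ∀ ξ η : Fin d → ℤ, (bracket ξ ^ r * (bracket (ξ - η) ^ (-r) * bracket η ^ (-r))) *
      (α (ξ - η) * β η) =
      bracket ξ ^ r * (bracket (ξ - η) ^ (-r) * α (ξ - η) * (bracket η ^ (-r) * β η)) := by
    intros
    ring
  simp only [hre, tsum_mul_left] at hcs
  have hb : ∀ ξ, (bracket ξ ^ r *
      ∑' η, bracket (ξ - η) ^ (-r) * α (ξ - η) * (bracket η ^ (-r) * β η)) ^ 2 ≤
      (4 ^ r * (2 * ∑' ξ : Fin d → ℤ, bracket ξ ^ (-(2 * r)))) *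
        ∑' η, α (ξ - η) ^ 2 * β η ^ 2 := by
    intro ξ
    refine (hcs ξ).2.trans ?_
    simp only [mul_pow (α _)]
    refine mul_le_mul_of_nonneg_right ?_ (tsum_nonneg fun η => by positivity)
    rw [← (hw ξ).tsum_eq]
    exact Summable.tsum_le_tsum (bracket_weight_le hr0 ξ) (hw2 ξ) (hw ξ).summable
  have hsum := hc2.mul_left (4 ^ r * (2 * ∑' ξ : Fin d → ℤ, bracket ξ ^ (-(2 * r))))
  have hs1 : Summable (fun ξ => (bracket ξ ^ r *
      ∑' η, bracket (ξ - η) ^ (-r) * α (ξ - η) * (bracket η ^ (-r) * β η)) ^ 2) :=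
    Summable.of_nonneg_of_le (fun _ => sq_nonneg _) hb hsum.summable
  refine ⟨fun ξ => ?_, hs1, ?_⟩
  · exact (summable_mul_left_iff (Real.rpow_pos_of_pos (bracket_pos ξ) r).ne').mp (hcs ξ).1
  · rw [← hsum.tsum_eq]
    exact Summable.tsum_le_tsum hb hs1 hsum.summable

end Summability

/-! ### The transport term as a bounded bilinear map -/

section Products

variable {d : ℕ}

theorem hasSum_euclidean {ι : Type*} {n : ℕ} {f : ι → EuclideanSpace ℂ (Fin n)}
    {a : EuclideanSpace ℂ (Fin n)} (h : ∀ i, HasSum (fun k => f k i) (a i)) : HasSum f a :=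
  (Pi.hasSum (f := fun k i => f k i) (g := fun i => a i)).mpr h |>.mapL
    (EuclideanSpace.equiv (Fin n) ℂ).symm.toContinuousLinearMap

/-- An absolutely summable Fourier series converges uniformly, and its `L²` limit must be `f`; hence
`f` is essentially bounded. -/
theorem ae_norm_le_tsum {f : Lp ℂ 2 (volume : Measure (Torus d))}
    (hf : Summable fun ξ => ‖ccoeff f ξ‖) : ∀ᵐ x, ‖f x‖ ≤ ∑' ξ, ‖ccoeff f ξ‖ := by
  have hn : ∀ ξ, ‖ccoeff f ξ • character ξ‖ ≤ ‖ccoeff f ξ‖ := by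
    intro ξ
    rw [norm_smul]
    refine mul_le_of_le_one_right (norm_nonneg _) ?_
    exact (ContinuousMap.norm_le _ zero_le_one).mpr fun x => (norm_character_apply ξ x).le
  have hs : Summable fun ξ => ccoeff f ξ • character ξ := Summable.of_norm_bounded hf hn
  have h1 := hs.hasSum.mapL (ContinuousMap.toLp (E := ℂ) 2 (volume : Measure (Torus d)) ℂ)
  simp only [map_smul] at h1
  have h2 := h1.unique (hasSum_ccoeff_smul f)
  have h3 := ContinuousMap.coeFn_toLp (p := 2) (𝕜 := ℂ) (volume : Measure (Torus d))
    (∑' ξ, ccoeff f ξ • character ξ)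
  rw [h2] at h3
  filter_upwards [h3] with x hx
  rw [hx]
  refine (ContinuousMap.norm_coe_le_norm _ x).trans ?_
  exact tsum_of_norm_bounded hf.hasSum hn

/-- The Fourier coefficients of a product of two functions of `L²`. -/
theorem hasSum_ccoeff_mul (f g : Lp ℂ 2 (volume : Measure (Torus d))) (ξ : Fin d → ℤ) :
    HasSum (fun η => ccoeff f (ξ - η) * ccoeff g η)
      (((torusVol d : ℝ) : ℂ)⁻¹ * ∫ x, f x * g x * character (-ξ) x) := by
  -- The coefficient of `f g` at `ξ` is a multiple of the inner product of `conj f · e^{ix·ξ}` with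
  -- `g`. The conjugated coefficient of the former at `η` is that of `f` at `ξ - η`, so Parseval
  -- yields the convolution.
  have hmem : MemLp (fun x => starRingEnd ℂ (f x) * character ξ x) 2
      (volume : Measure (Torus d)) := by
    refine (Lp.memLp f).of_le_mul (c := 1) ?_ (ae_of_all _ fun x => ?_)
    · exact (Complex.continuous_conj.comp_aestronglyMeasurable
        (Lp.aestronglyMeasurable f)).mul (character ξ).continuous.aestronglyMeasurable
    · rw [norm_mul, norm_character_apply, RCLike.norm_conj, mul_one, one_mul]
  have h := hasSum_conj_ccoeff_mul (hmem.toLp _) g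
  convert h using 1
  · ext η
    congr 1
    rw [ccoeff_eq_integral, ccoeff_eq_integral, map_mul, ← integral_conj, map_inv₀,
      Complex.conj_ofReal]
    congr 1
    refine integral_congr_ae ?_
    filter_upwards [hmem.coeFn_toLp] with x hx
    rw [hx, map_mul, map_mul, Complex.conj_conj, ← character_neg, ← character_neg, neg_neg,
      neg_sub, sub_eq_neg_add, character_add, mul_assoc]
  · rw [L2.inner_def]
    congr 1
    refine integral_congr_ae ?_
    filter_upwards [hmem.coeFn_toLp] with x hx
    rw [hx, RCLike.inner_apply, map_mul, Complex.conj_conj, ← character_neg]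
    ring

theorem ae_norm_apply_le {n : ℕ} {a : L2 d n} (ha : Summable fun ξ => ‖coeff a ξ‖) (j : Fin n) :
    ∀ᵐ x, |a x j| ≤ ∑' ξ, ‖coeff a ξ‖ := by
  have hle : ∀ ξ, ‖ccoeff (compC j a) ξ‖ ≤ ‖coeff a ξ‖ := fun ξ => by
    rw [← coeff_apply]
    exact PiLp.norm_apply_le _ _
  have h1 : Summable fun ξ => ‖ccoeff (compC j a) ξ‖ :=
    Summable.of_nonneg_of_le (fun _ => norm_nonneg _) hle ha
  filter_upwards [ae_norm_le_tsum h1, coeFn_compC j a] with x h2 h3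
  rw [h3, Complex.norm_real, Real.norm_eq_abs] at h2
  exact h2.trans (Summable.tsum_le_tsum hle h1 ha)

/-- A bounded field times an `L²` derivative is in `L²`; this keeps `toL2` away from its default
value 0 in `advect`. -/
theorem memLp_advect {a : L2 d d} (ha : Summable fun ξ => ‖coeff a ξ‖) (b : L2 d d) :
    MemLp (fun x => ∑ j : Fin d, a x j • partialD j b x) 2 (volume : Measure (Torus d)) := by
  refine memLp_finsetSum _ fun j _ => ?_
  refine (Lp.memLp (partialD j b)).of_le_mul (c := ∑' ξ, ‖coeff a ξ‖) ?_ ?_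
  · exact ((EuclideanSpace.proj j : Vec d →L[ℝ] ℝ).continuous.comp_aestronglyMeasurable
      (Lp.aestronglyMeasurable a)).smul (Lp.aestronglyMeasurable _)
  · filter_upwards [ae_norm_apply_le ha j] with x hx
    rw [norm_smul, Real.norm_eq_abs]
    gcongr

/-- The Fourier coefficients of `a · ∇ b`. -/
theorem hasSum_coeff_advect {a b : L2 d d} (ha : Summable fun ξ => ‖coeff a ξ‖) (hb : MemHs 1 b)
    (ξ : Fin d → ℤ) :
    HasSum (fun η => (∑ j, coeff a (ξ - η) j * (Complex.I * (η j : ℂ))) • coeff b η)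
      (coeff (advect a b) ξ) := by
  have hmem := memLp_advect ha b
  have hadv : advect a b =ᵐ[volume] fun x => ∑ j : Fin d, a x j • partialD j b x := by
    rw [advect, toL2, dif_pos hmem]
    exact hmem.coeFn_toLp
  refine hasSum_euclidean fun i => ?_
  have h1 : ∀ j : Fin d, HasSum
      (fun η => coeff a (ξ - η) j * (Complex.I * (η j : ℂ)) * coeff b η i)
      (((torusVol d : ℝ) : ℂ)⁻¹ * ∫ x, compC j a x * compC i (partialD j b) x *
        character (-ξ) x) := by
    intro j
    refine (hasSum_ccoeff_mul (compC j a) (compC i (partialD j b)) ξ).congr_fun fun η => ?_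
    rw [← coeff_apply, ← coeff_apply, coeff_partialD j hb, PiLp.smul_apply, smul_eq_mul, mul_assoc]
  have h2 := hasSum_sum (s := Finset.univ) fun j _ => h1 j
  convert h2 using 1
  · ext η
    rw [PiLp.smul_apply, smul_eq_mul, Finset.sum_mul]
  · rw [← Finset.mul_sum, ← integral_finsetSum]
    · simp only [coeff]
      congr 1
      refine integral_congr_ae ?_
      have h : ∀ᵐ x : Torus d, ∀ j, compC j a x = ((a x j : ℝ) : ℂ) ∧
          compC i (partialD j b) x = ((partialD j b x i : ℝ) : ℂ) := by
        rw [ae_all_iff]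
        intro j
        filter_upwards [coeFn_compC j a, coeFn_compC i (partialD j b)] with x h1 h2 using ⟨h1, h2⟩
      filter_upwards [hadv, h] with x hx h
      simp only [hx, (h _).1, (h _).2, ← Finset.sum_mul]
      congr 1
      simp
    · intro j _
      refine Integrable.mul_bdd (c := 1) ?_ (character (-ξ)).continuous.aestronglyMeasurable
        (ae_of_all _ fun x => (norm_character_apply _ x).le)
      exact (Lp.memLp (compC j a)).integrable_mul (Lp.memLp (compC i (partialD j b)))

theorem norm_advect_symbol_le (z : EuclideanSpace ℂ (Fin d)) (η : Fin d → ℤ) :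
    ‖∑ j, z j * (Complex.I * (η j : ℂ))‖ ≤ ‖z‖ * bracket η := by
  have h := norm_inner_le_norm (𝕜 := ℂ)
    (WithLp.toLp 2 fun j => -(Complex.I * (η j : ℂ)) : EuclideanSpace ℂ (Fin d)) z
  have h1 : inner ℂ (WithLp.toLp 2 fun j => -(Complex.I * (η j : ℂ)) : EuclideanSpace ℂ (Fin d)) z =
      ∑ j, z j * (Complex.I * (η j : ℂ)) := by
    simp [PiLp.inner_apply]
  rw [h1] at h
  refine h.trans ?_
  rw [mul_comm]
  gcongr
  refine le_trans (le_of_eq ?_) (sqrt_freqSq_le_bracket η)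
  rw [EuclideanSpace.norm_eq]
  simp [freqSq]

/-- The Sobolev embedding in Wiener algebra form: Cauchy–Schwarz against `⟨ξ⟩^{-s}`, square summable
because `2s > d`. -/
theorem summable_norm_coeff {s : ℝ} (hs : (d : ℝ) / 2 < s) {n : ℕ} {a : L2 d n}
    (ha : MemHs s a) : Summable fun ξ => ‖coeff a ξ‖ := by
  have hs0 : 0 ≤ s := by
    have : (0 : ℝ) ≤ d := by positivity
    linarith
  obtain ⟨A, rfl⟩ := ha.exists_smooth hs0
  have h := (tsum_mul_sq_le (f := fun ξ : Fin d → ℤ => bracket ξ ^ (-s))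
    (g := fun ξ => ‖coeff A ξ‖) (fun ξ => Real.rpow_nonneg (bracket_pos ξ).le _)
    (fun ξ => norm_nonneg _) ?_ (hasSum_norm_sq_coeff A).summable).1
  · refine h.congr fun ξ => ?_
    rw [coeff_smooth hs0, norm_smul, Real.norm_of_nonneg (Real.rpow_nonneg (bracket_pos ξ).le _)]
  · refine (summable_bracket_rpow (r := 2 * s) (by linarith)).congr fun ξ => ?_
    rw [← Real.rpow_mul_natCast (bracket_pos ξ).le]
    congr 1
    push_cast
    ring

variable {s : ℝ}

theorem hasSum_coeff_advect_smooth (hs : (d : ℝ) / 2 + 1 < s) (A B : L2 d d) (ξ : Fin d → ℤ) :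
    HasSum (fun η => (∑ j, coeff (smooth s A) (ξ - η) j * (Complex.I * (η j : ℂ))) •
      coeff (smooth s B) η) (coeff (advect (smooth s A) (smooth s B)) ξ) := by
  have : (0 : ℝ) ≤ d := by positivity
  exact hasSum_coeff_advect (summable_norm_coeff (by linarith) (memHs_smooth (by linarith) A))
    ((memHs_smooth (by linarith) B).mono (by linarith)) ξ

/-- The transport term loses one derivative. -/
theorem exists_advect_smooth (hs : (d : ℝ) / 2 + 1 < s) :
    ∃ C : ℝ, 0 ≤ C ∧ ∀ A B : L2 d d, ∃ G : L2 d d,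
      smooth (s - 1) G = advect (smooth s A) (smooth s B) ∧ ‖G‖ ≤ C * ‖A‖ * ‖B‖ := by
  have hd : (0 : ℝ) ≤ d := by positivity
  have hs0 : 0 ≤ s := by linarith
  have hs1 : 0 ≤ s - 1 := by linarith
  set S := (4 : ℝ) ^ (s - 1) * (2 * ∑' ξ : Fin d → ℤ, bracket ξ ^ (-(2 * (s - 1)))) with hS
  have hS0 : 0 ≤ S := by
    have : 0 ≤ ∑' ξ : Fin d → ℤ, bracket ξ ^ (-(2 * (s - 1))) :=
      tsum_nonneg fun ξ => Real.rpow_nonneg (bracket_pos ξ).le _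
    positivity
  -- Parseval gives one factor `vol^{-1}` for each of `G`, `A` and `B`; one of them survives.
  refine ⟨Real.sqrt (S * (torusVol d)⁻¹), Real.sqrt_nonneg _, fun A B => ?_⟩
  obtain ⟨h1, h2, h3⟩ := convolution_bracket_le (r := s - 1) (by linarith)
    (fun ξ => norm_nonneg (coeff A ξ)) (fun ξ => norm_nonneg (coeff B ξ))
    (hasSum_norm_sq_coeff A).summable (hasSum_norm_sq_coeff B).summable
  have hb : ∀ ξ, ‖coeff (advect (smooth s A) (smooth s B)) ξ‖ ≤
      ∑' η, bracket (ξ - η) ^ (-(s - 1)) * ‖coeff A (ξ - η)‖ *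
        (bracket η ^ (-(s - 1)) * ‖coeff B η‖) := by
    intro ξ
    rw [← (hasSum_coeff_advect_smooth hs A B ξ).tsum_eq]
    refine tsum_of_norm_bounded (h1 ξ).hasSum fun η => ?_
    rw [norm_smul]
    refine (mul_le_mul_of_nonneg_right (norm_advect_symbol_le _ η) (norm_nonneg _)).trans ?_
    rw [coeff_smooth hs0, coeff_smooth hs0, norm_smul, norm_smul,
      Real.norm_of_nonneg (Real.rpow_nonneg (bracket_pos _).le _),
      Real.norm_of_nonneg (Real.rpow_nonneg (bracket_pos _).le _)]
    -- The derivative falls on `B` and lowers its weight from `s` to `s - 1`. The weight of `A` can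
    -- be relaxed to `s - 1` as well, which is the symmetric situation of `convolution_bracket_le`.
    have e1 : bracket η * bracket η ^ (-s) = bracket η ^ (-(s - 1)) := by
      nth_rw 1 [← Real.rpow_one (bracket η)]
      rw [← Real.rpow_add (bracket_pos η)]
      congr 1
      ring
    have e2 : bracket (ξ - η) ^ (-s) ≤ bracket (ξ - η) ^ (-(s - 1)) :=
      Real.rpow_le_rpow_of_exponent_le (one_le_bracket _) (by linarith)
    calc bracket (ξ - η) ^ (-s) * ‖coeff A (ξ - η)‖ * bracket η * (bracket η ^ (-s) * ‖coeff B η‖)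
        = bracket (ξ - η) ^ (-s) * ‖coeff A (ξ - η)‖ *
          ((bracket η * bracket η ^ (-s)) * ‖coeff B η‖) := by ring
      _ ≤ _ := by
        rw [e1]
        have := Real.rpow_nonneg (bracket_pos η).le (-(s - 1))
        gcongr
  have hb2 : ∀ ξ, bracket ξ ^ (2 * (s - 1)) * ‖coeff (advect (smooth s A) (smooth s B)) ξ‖ ^ 2 ≤
      (bracket ξ ^ (s - 1) * ∑' η, bracket (ξ - η) ^ (-(s - 1)) * ‖coeff A (ξ - η)‖ *
        (bracket η ^ (-(s - 1)) * ‖coeff B η‖)) ^ 2 := by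
    intro ξ
    rw [mul_pow, ← Real.rpow_mul_natCast (bracket_pos ξ).le, mul_comm (s - 1)]
    have := Real.rpow_nonneg (bracket_pos ξ).le (((2 : ℕ) : ℝ) * (s - 1))
    push_cast at this ⊢
    gcongr
    exact hb ξ
  have hmem : MemHs (s - 1) (advect (smooth s A) (smooth s B)) :=
    Summable.of_nonneg_of_le
      (fun ξ => mul_nonneg (Real.rpow_nonneg (bracket_pos ξ).le _) (by positivity)) hb2 h2
  obtain ⟨G, hG⟩ := hmem.exists_smooth hs1
  refine ⟨G, hG, ?_⟩
  have h4 := (Summable.tsum_le_tsum hb2 hmem h2).trans h3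
  rw [← hG] at h4
  simp only [bracket_rpow_mul_coeff_smooth hs1] at h4
  rw [(hasSum_norm_sq_coeff G).tsum_eq, (hasSum_norm_sq_coeff A).tsum_eq,
    (hasSum_norm_sq_coeff B).tsum_eq, ← hS] at h4
  have hv := torusVol_pos d
  refine abs_le_of_sq_le_sq' ?_ (by positivity) |>.2
  rw [mul_pow, mul_pow, Real.sq_sqrt (by positivity)]
  have h5 := mul_le_mul_of_nonneg_left h4 hv.le
  rw [mul_inv_cancel_left₀ hv.ne'] at h5
  refine h5.trans_eq ?_
  field_simp

/-- The projected transport term `𝔏(a · ∇ b)` as a continuous bilinear map, after the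
identification of `H^s` and `H^{s-1}` with `L²`. -/
theorem exists_bilinear (hs : (d : ℝ) / 2 + 1 < s) :
    ∃ N : L2 d d →L[ℝ] L2 d d →L[ℝ] L2 d d, ∀ A B : L2 d d,
      smooth (s - 1) (N A B) = leray (advect (smooth s A) (smooth s B)) := by
  have hd : (0 : ℝ) ≤ d := by positivity
  have hs1 : 0 ≤ s - 1 := by linarith
  obtain ⟨C, hC, h⟩ := exists_advect_smooth hs
  choose G hG hG2 using h
  -- `G` is only a chosen preimage. Its bilinearity is read off from this series, linear in each
  -- argument, through the injectivity of `smooth`.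
  have key : ∀ A B ξ, HasSum (fun η => (∑ j, coeff (smooth s A) (ξ - η) j *
      (Complex.I * (η j : ℂ))) • coeff (smooth s B) η) (coeff (smooth (s - 1) (G A B)) ξ) := by
    intro A B ξ
    rw [hG]
    exact hasSum_coeff_advect_smooth hs A B ξ
  have inj := smooth_injective (d := d) (n := d) hs1
  let L : L2 d d →ₗ[ℝ] L2 d d →ₗ[ℝ] L2 d d := LinearMap.mk₂ ℝ G
    (fun A A' B => inj <| ext_coeff fun ξ => by
      rw [map_add, coeff_add]
      refine (key _ _ ξ).unique (((key A B ξ).add (key A' B ξ)).congr_fun fun η => ?_)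
      rw [map_add, coeff_add, ← add_smul, ← Finset.sum_add_distrib]
      simp only [PiLp.add_apply, add_mul])
    (fun c A B => inj <| ext_coeff fun ξ => by
      rw [map_smul, coeff_smul]
      refine (key _ _ ξ).unique (((key A B ξ).const_smul c).congr_fun fun η => ?_)
      rw [map_smul, coeff_smul, ← smul_assoc, Finset.smul_sum]
      simp only [PiLp.smul_apply, smul_mul_assoc])
    (fun A B B' => inj <| ext_coeff fun ξ => by
      rw [map_add, coeff_add]
      refine (key _ _ ξ).unique (((key A B ξ).add (key A B' ξ)).congr_fun fun η => ?_)
      rw [map_add, coeff_add, smul_add])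
    (fun c A B => inj <| ext_coeff fun ξ => by
      rw [map_smul, coeff_smul]
      refine (key _ _ ξ).unique (((key A B ξ).const_smul c).congr_fun fun η => ?_)
      rw [map_smul, coeff_smul, smul_comm])
  refine ⟨(ContinuousLinearMap.compL ℝ (L2 d d) (L2 d d) (L2 d d) leray).comp
    (L.mkContinuous₂ C hG2), fun A B => ?_⟩
  rw [← hG, leray_smooth hs1]
  rfl

/-- `𝔏(a · ∇ b)` has zero average when `div a = 0`. -/
theorem coeff_zero_leray_advect (hs : (d : ℝ) / 2 + 1 < s) {A : L2 d d} (hA : A ∈ divFree d)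
    (B : L2 d d) : coeff (leray (advect (smooth s A) (smooth s B))) 0 = 0 := by
  have hs0 : 0 ≤ s := by
    have : (0 : ℝ) ≤ d := by positivity
    linarith
  -- At output frequency 0 the coefficient of `a` at `-η` is contracted with `η`: that is the
  -- divergence of `a`, so each term vanishes.
  have h0 : coeff (advect (smooth s A) (smooth s B)) 0 = 0 := by
    refine (hasSum_coeff_advect_smooth hs A B 0).unique ?_
    refine hasSum_zero.congr_fun fun η => ?_
    have h := (smooth_mem_divFree_iff hs0 A).mpr hA (0 - η)
    have h1 : ∑ j, coeff (smooth s A) (0 - η) j * (Complex.I * (η j : ℂ)) =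
        -Complex.I * ∑ j, (((0 - η) j : ℤ) : ℂ) * coeff (smooth s A) (0 - η) j := by
      rw [Finset.mul_sum]
      refine Finset.sum_congr rfl fun j _ => ?_
      rw [Pi.sub_apply, Pi.zero_apply, zero_sub]
      push_cast
      ring
    rw [h1, h, mul_zero, zero_smul]
  classical
  -- The projection onto constants is a multiplier, so it commutes with `leray` and the zero mode
  -- survives the projection as zero.
  have hm : IsSymbol fun ξ : Fin d → ℤ => if ξ = 0 then (1 : ℝ) else 0 :=
    ⟨fun ξ => by simp, 1, fun ξ => by
      dsimp only
      split_ifs <;> simp⟩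
  have h1 : mult (fun ξ : Fin d → ℤ => if ξ = 0 then (1 : ℝ) else 0)
      (advect (smooth s A) (smooth s B)) = 0 := by
    refine ext_coeff fun ξ => ?_
    rw [coeff_mult hm, coeff_zero]
    split_ifs with h
    · rw [h, h0, smul_zero]
    · rw [zero_smul]
  have h2 := leray_mult hm (advect (smooth s A) (smooth s B))
  rw [h1, map_zero] at h2
  have h3 := congrArg (fun u => coeff u 0) h2
  simp only [coeff_mult hm, coeff_zero, if_true, one_smul] at h3
  exact h3.symm

end Products

/-! ### Integral equations of convolution type in a Banach space -/

section Mild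

variable {E : Type*} [NormedAddCommGroup E] [NormedSpace ℝ E]

/-- The convolution `∫_0^t K(r) G(t - r) dr` (equal to `0` for `t ≤ 0`). -/
def conv (K : ℝ → E →L[ℝ] E) (G : ℝ → E) (t : ℝ) : E :=
  ∫ r in Set.Ioi (0 : ℝ), (Set.Iio t).indicator (fun r => K r (G (t - r))) r

/-- The family `K` is strongly continuous on `(0, ∞)` and dominated by the integrable function
`k`. -/
structure IsKernel (K : ℝ → E →L[ℝ] E) (k : ℝ → ℝ) : Prop where
  cont : ContinuousOn (fun p : ℝ × E => K p.1 p.2) (Set.Ioi 0 ×ˢ Set.univ)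
  integrable : IntegrableOn k (Set.Ioi 0)
  bound : ∀ r, 0 < r → ‖K r‖ ≤ k r

namespace IsKernel

variable {K : ℝ → E →L[ℝ] E} {k : ℝ → ℝ} {G : ℝ → E} {M : ℝ}

theorem norm_integrand_le (h : IsKernel K k) (hM : ∀ τ, ‖G τ‖ ≤ M) (t : ℝ) {r : ℝ} (hr : 0 < r) :
    ‖(Set.Iio t).indicator (fun r => K r (G (t - r))) r‖ ≤ k r * M := by
  refine (norm_indicator_le_norm_self _ _).trans ?_
  refine ((K r).le_opNorm _).trans ?_
  exact mul_le_mul (h.bound r hr) (hM _) (norm_nonneg _) ((norm_nonneg _).trans (h.bound r hr))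

theorem aestronglyMeasurable (h : IsKernel K k) (hG : Continuous G) (t : ℝ) :
    AEStronglyMeasurable (fun r => (Set.Iio t).indicator (fun r => K r (G (t - r))) r)
      (volume.restrict (Set.Ioi (0 : ℝ))) := by
  refine AEStronglyMeasurable.indicator ?_ measurableSet_Iio
  refine ContinuousOn.aestronglyMeasurable ?_ measurableSet_Ioi
  exact h.cont.comp (f := fun r : ℝ => (r, G (t - r))) (by fun_prop) fun r hr => ⟨hr, trivial⟩

theorem integrable_conv (h : IsKernel K k) (hG : Continuous G) (hM : ∀ τ, ‖G τ‖ ≤ M) (t : ℝ) :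
    IntegrableOn (fun r => (Set.Iio t).indicator (fun r => K r (G (t - r))) r) (Set.Ioi 0) := by
  refine Integrable.mono' (h.integrable.mul_const M) (h.aestronglyMeasurable hG t) ?_
  exact (ae_restrict_iff' measurableSet_Ioi).mpr (ae_of_all _ fun r hr =>
    h.norm_integrand_le hM t hr)

theorem norm_conv_le (h : IsKernel K k) (hM : ∀ τ, ‖G τ‖ ≤ M) (t : ℝ) :
    ‖conv K G t‖ ≤ (∫ r in Set.Ioi (0 : ℝ), k r) * M := by
  rw [← integral_mul_const]
  refine norm_integral_le_of_norm_le (h.integrable.mul_const M) ?_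
  exact (ae_restrict_iff' measurableSet_Ioi).mpr (ae_of_all _ fun r hr =>
    h.norm_integrand_le hM t hr)

/-- The domain of integration is fixed and `t` enters only through the integrand, which is
continuous in `t` except when `r = t`, a null set; dominated convergence concludes. -/
theorem continuous_conv (h : IsKernel K k) (hG : Continuous G) (hM : ∀ τ, ‖G τ‖ ≤ M) :
    Continuous (conv K G) := by
  rw [continuous_iff_continuousAt]
  intro t
  refine continuousAt_of_dominated (bound := fun r => k r * M)
    (Eventually.of_forall fun x => h.aestronglyMeasurable hG x)
    (Eventually.of_forall fun x => (ae_restrict_iff' measurableSet_Ioi).mpr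
      (ae_of_all _ fun r hr => h.norm_integrand_le hM x hr)) (h.integrable.mul_const M) ?_
  refine (ae_restrict_iff' measurableSet_Ioi).mpr ?_
  filter_upwards [compl_mem_ae_iff.mpr (measure_singleton t)] with r hr _
  have hc : Continuous fun x => K r (G (x - r)) := (K r).continuous.comp (by fun_prop)
  rcases lt_or_gt_of_ne (show r ≠ t from hr) with hlt | hgt
  · refine hc.continuousAt.congr ?_
    filter_upwards [lt_mem_nhds hlt] with x hx
    rw [Set.indicator_of_mem (show r ∈ Set.Iio x from hx)]
  · refine (continuousAt_const (y := (0 : E))).congr ?_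
    filter_upwards [gt_mem_nhds hgt] with x hx
    rw [Set.indicator_of_notMem (show r ∉ Set.Iio x from not_lt.mpr (le_of_lt hx))]

theorem conv_sub (h : IsKernel K k) {G' : ℝ → E} {M' : ℝ} (hG : Continuous G)
    (hM : ∀ τ, ‖G τ‖ ≤ M) (hG' : Continuous G') (hM' : ∀ τ, ‖G' τ‖ ≤ M') (t : ℝ) :
    conv K G t - conv K G' t = conv K (fun τ => G τ - G' τ) t := by
  unfold conv
  rw [← integral_sub (h.integrable_conv hG hM t) (h.integrable_conv hG' hM' t)]
  congr 1
  ext r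
  simp only [map_sub]
  exact (congrFun (Set.indicator_sub (Set.Iio t) (fun r => K r (G (t - r)))
    (fun r => K r (G' (t - r)))) r).symm

end IsKernel

/-- Solvability, in the small, of a quadratic integral equation of convolution type. -/
theorem exists_mild_solution [CompleteSpace E] {K : ℝ → E →L[ℝ] E} {k : ℝ → ℝ} (h : IsKernel K k)
    (B : E →L[ℝ] E →L[ℝ] E) {y U : ℝ → E} {e : ℝ → ℝ} {η ρ : ℝ} (hη : 0 ≤ η)
    (hy : Continuous y) (hyη : ∀ t, ‖y t‖ ≤ η) (hU : Continuous U) (hUρ : ∀ t, ‖U t‖ ≤ ρ)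
    (he : Continuous e) (he1 : ∀ t, |e t| ≤ 1)
    (hsmall : (∫ r in Set.Ioi (0 : ℝ), k r) * (‖B‖ * (2 * ρ + 4 * η)) ≤ 1 / 2) :
    ∃ W : ℝ → E, Continuous W ∧ (∀ t, ‖W t‖ ≤ 2 * η) ∧ ∀ t,
      W t = y t - conv K (fun τ => B (U τ) (W τ) + B (W τ) (U τ) + e τ • B (W τ) (W τ)) t := by
  set κ := ∫ r in Set.Ioi (0 : ℝ), k r with hκ
  have hκ0 : 0 ≤ κ := setIntegral_nonneg measurableSet_Ioi fun r hr =>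
    (norm_nonneg _).trans (h.bound r hr)
  let nl : (ℝ → E) → ℝ → E := fun W τ => B (U τ) (W τ) + B (W τ) (U τ) + e τ • B (W τ) (W τ)
  have nl_cont : ∀ W : ℝ → E, Continuous W → Continuous (nl W) := by
    intro W hW
    have h1 : Continuous fun τ => B (U τ) (W τ) := (B.continuous.comp hU).clm_apply hW
    have h2 : Continuous fun τ => B (W τ) (U τ) := (B.continuous.comp hW).clm_apply hU
    have h3 : Continuous fun τ => B (W τ) (W τ) := (B.continuous.comp hW).clm_apply hW
    exact (h1.add h2).add (he.smul h3)
  have nl_sub : ∀ (W W' : ℝ → E) (R D : ℝ), (∀ t, ‖W t‖ ≤ R) → (∀ t, ‖W' t‖ ≤ R) →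
      (∀ t, ‖W t - W' t‖ ≤ D) → ∀ τ, ‖nl W τ - nl W' τ‖ ≤ ‖B‖ * (2 * ρ + 2 * R) * D := by
    intro W W' R D hW hW' hD τ
    have hR : 0 ≤ R := (norm_nonneg _).trans (hW 0)
    -- The quadratic difference is split as `B(W, W - W') + B(W - W', W')`, so every term is linear
    -- in `W - W'`.
    have e1 : nl W τ - nl W' τ = B (U τ) (W τ - W' τ) + B (W τ - W' τ) (U τ) +
        e τ • (B (W τ) (W τ - W' τ) + B (W τ - W' τ) (W' τ)) := by
      simp only [nl, map_sub, sub_apply, smul_add, smul_sub]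
      abel
    have hb : ∀ a b : E, ∀ p q : ℝ, ‖a‖ ≤ p → ‖b‖ ≤ q → ‖B a b‖ ≤ ‖B‖ * p * q := by
      intro a b p q ha hb
      refine (B.le_opNorm₂ a b).trans ?_
      have := (norm_nonneg a).trans ha
      gcongr
    have h1 := hb _ _ _ _ (hUρ τ) (hD τ)
    have h2 := hb _ _ _ _ (hD τ) (hUρ τ)
    have h3 := hb _ _ _ _ (hW τ) (hD τ)
    have h4 := hb _ _ _ _ (hD τ) (hW' τ)
    rw [e1]
    refine (norm_add_le _ _).trans ?_
    have h5 : ‖e τ • (B (W τ) (W τ - W' τ) + B (W τ - W' τ) (W' τ))‖ ≤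
        ‖B (W τ) (W τ - W' τ)‖ + ‖B (W τ - W' τ) (W' τ)‖ := by
      rw [norm_smul]
      refine (mul_le_of_le_one_left (norm_nonneg _) (he1 τ)).trans (norm_add_le _ _)
    have h6 := norm_add_le (B (U τ) (W τ - W' τ)) (B (W τ - W' τ) (U τ))
    linarith
  have nl_zero : nl (fun _ => 0) = fun _ => 0 := by
    funext τ
    simp [nl]
  have nl_bound : ∀ (W : ℝ → E) (R : ℝ), (∀ t, ‖W t‖ ≤ R) →
      ∀ τ, ‖nl W τ‖ ≤ ‖B‖ * (2 * ρ + 2 * R) * R := by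
    intro W R hW τ
    have := nl_sub W (fun _ => 0) R R hW
      (fun t => by simpa using (norm_nonneg _).trans (hW 0)) (fun t => by simpa using hW t) τ
    simpa [nl_zero] using this
  let Φ : BoundedContinuousFunction ℝ E → BoundedContinuousFunction ℝ E := fun W =>
    BoundedContinuousFunction.ofNormedAddCommGroup (fun t => y t - conv K (nl W) t)
      (hy.sub (h.continuous_conv (nl_cont W W.continuous)
        (nl_bound W ‖W‖ fun t => W.norm_coe_le_norm t)))
      (η + κ * (‖B‖ * (2 * ρ + 2 * ‖W‖) * ‖W‖)) fun t => (norm_sub_le _ _).trans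
        (add_le_add (hyη t) (h.norm_conv_le (nl_bound W ‖W‖ fun t => W.norm_coe_le_norm t) t))
  have Φ_apply : ∀ W t, Φ W t = y t - conv K (nl W) t := fun _ _ => rfl
  -- On the ball of radius `2η` the nonlinear term has Lipschitz constant `‖B‖(2ρ + 4η)`. After
  -- convolution this is at most `1/2`, so `Φ` contracts, and the ball is stable because `η +
  -- (1/2)(2η) = 2η`.
  let s : Set (BoundedContinuousFunction ℝ E) := Metric.closedBall 0 (2 * η)
  have hs : ∀ W ∈ s, ∀ t, ‖W t‖ ≤ 2 * η := fun W hW t =>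
    (W.norm_coe_le_norm t).trans (mem_closedBall_zero_iff.mp hW)
  have hB := norm_nonneg B
  have hmaps : Set.MapsTo Φ s s := by
    intro W hW
    refine mem_closedBall_zero_iff.mpr
      ((BoundedContinuousFunction.norm_le (by positivity)).mpr fun t => ?_)
    rw [Φ_apply]
    have h1 := h.norm_conv_le (nl_bound W _ (hs W hW)) t
    have h2 := mul_le_mul_of_nonneg_right hsmall (show 0 ≤ 2 * η by positivity)
    have h3 := norm_sub_le (y t) (conv K (nl W) t)
    have h4 := hyη t
    have h5 : κ * (‖B‖ * (2 * ρ + 2 * (2 * η)) * (2 * η)) =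
      κ * (‖B‖ * (2 * ρ + 4 * η)) * (2 * η) := by ring
    linarith
  have hcontr : ContractingWith (1 / 2) (hmaps.restrict Φ s s) := by
    refine ⟨by rw [← NNReal.coe_lt_coe]; norm_num, LipschitzWith.of_dist_le_mul ?_⟩
    rintro ⟨W, hW⟩ ⟨W', hW'⟩
    change dist (Φ W) (Φ W') ≤ _ * dist W W'
    refine (BoundedContinuousFunction.dist_le (by positivity)).mpr fun t => ?_
    rw [dist_eq_norm, Φ_apply, Φ_apply, sub_sub_sub_cancel_left,
      h.conv_sub (nl_cont W' W'.continuous) (nl_bound W' _ (hs W' hW'))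
        (nl_cont W W.continuous) (nl_bound W _ (hs W hW))]
    have h1 := h.norm_conv_le (nl_sub W' W _ (dist W W') (hs W' hW') (hs W hW) fun t => by
      rw [← dist_eq_norm, dist_comm]
      exact BoundedContinuousFunction.dist_coe_le_dist t) t
    have h2 := mul_le_mul_of_nonneg_right hsmall (dist_nonneg (x := W) (y := W'))
    have h5 : κ * (‖B‖ * (2 * ρ + 2 * (2 * η)) * dist W W') =
      κ * (‖B‖ * (2 * ρ + 4 * η)) * dist W W' := by ring
    have h6 : (((1 / 2 : NNReal) : ℝ)) = 1 / 2 := by norm_num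
    rw [h6]
    linarith
  obtain ⟨W, hW, hfix, -⟩ := hcontr.exists_fixedPoint'
    (Metric.isClosed_closedBall.isComplete) hmaps
    (x := 0) (Metric.mem_closedBall_self (by positivity)) (edist_ne_top _ _)
  refine ⟨W, W.continuous, hs W hW, fun t => ?_⟩
  rw [← Φ_apply W t, hfix.eq]

/-- Uniqueness for integral equations of convolution type with a locally Lipschitz right-hand
side. -/
theorem mild_unique {K : ℝ → E →L[ℝ] E} {k : ℝ → ℝ} (h : IsKernel K k) {V V' G G' y : ℝ → E}
    {M M' D L : ℝ} (hL : 0 ≤ L) (hG : Continuous G) (hM : ∀ τ, ‖G τ‖ ≤ M) (hG' : Continuous G')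
    (hM' : ∀ τ, ‖G' τ‖ ≤ M') (hV : ∀ t, 0 ≤ t → V t = y t - conv K G t)
    (hV' : ∀ t, 0 ≤ t → V' t = y t - conv K G' t)
    (hLip : ∀ τ, 0 ≤ τ → ‖G τ - G' τ‖ ≤ L * ‖V τ - V' τ‖) (hD : ∀ τ, 0 ≤ τ → ‖V τ - V' τ‖ ≤ D) :
    ∀ t, 0 ≤ t → V t = V' t := by
  have hk0 : ∀ r ∈ Set.Ioi (0 : ℝ), 0 ≤ k r := fun r hr => (norm_nonneg _).trans (h.bound r hr)
  -- The mass of `e^{-γr}k(r)` tends to 0 as `γ` grows, even though `L` and `k` are not small. Fix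
  -- `γ` so that `L` times this mass is at most `1/2`.
  have hlim : Tendsto (fun γ : ℝ => L * ∫ r in Set.Ioi (0 : ℝ), Real.exp (-γ * r) * k r) atTop
      (𝓝 (L * ∫ r in Set.Ioi (0 : ℝ), (0 : ℝ))) := by
    refine Tendsto.const_mul _ ?_
    refine tendsto_integral_filter_of_dominated_convergence k ?_ ?_ h.integrable ?_
    · refine Eventually.of_forall fun γ => ?_
      exact (by fun_prop : Continuous fun r : ℝ => Real.exp (-γ * r)).aestronglyMeasurable.mul
        h.integrable.aestronglyMeasurable
    · filter_upwards [eventually_ge_atTop 0] with γ hγ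
      refine (ae_restrict_iff' measurableSet_Ioi).mpr (ae_of_all _ fun r hr => ?_)
      rw [Real.norm_of_nonneg (mul_nonneg (Real.exp_pos _).le (hk0 r hr))]
      refine mul_le_of_le_one_left (hk0 r hr) (Real.exp_le_one_iff.mpr ?_)
      have : 0 < r := hr
      nlinarith
    · refine (ae_restrict_iff' measurableSet_Ioi).mpr (ae_of_all _ fun r hr => ?_)
      have hr : 0 < r := hr
      have h1 : Tendsto (fun γ : ℝ => Real.exp (-γ * r)) atTop (𝓝 0) := by
        refine Real.tendsto_exp_atBot.comp ?_
        exact (tendsto_neg_atTop_atBot).atBot_mul_const hr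
      simpa using h1.mul_const (k r)
  rw [integral_zero, mul_zero] at hlim
  obtain ⟨γ, hγ1, hγ0⟩ := ((hlim.eventually (ge_mem_nhds (show (0 : ℝ) < 1 / 2 by norm_num))).and
    (eventually_ge_atTop 0)).exists
  -- One use of the integral equations halves the constant in the bound `c e^{γt}`, since
  -- `e^{γ(t-r)} = e^{γt}e^{-γr}`. Starting from the a priori bound `D` and iterating forces the
  -- difference to vanish.
  have step : ∀ c, (∀ t, 0 ≤ t → ‖V t - V' t‖ ≤ c * Real.exp (γ * t)) →
      ∀ t, 0 ≤ t → ‖V t - V' t‖ ≤ c / 2 * Real.exp (γ * t) := by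
    intro c hc t ht
    have hc0 : 0 ≤ c := by
      have := (norm_nonneg _).trans (hc 0 le_rfl)
      simpa using this
    have hint : IntegrableOn (fun r => Real.exp (-γ * r) * k r) (Set.Ioi 0) := by
      refine h.integrable.mono'
        ((by fun_prop : Continuous fun r : ℝ => Real.exp (-γ * r)).aestronglyMeasurable.mul
          h.integrable.aestronglyMeasurable) ?_
      refine (ae_restrict_iff' measurableSet_Ioi).mpr (ae_of_all _ fun r hr => ?_)
      rw [Real.norm_of_nonneg (mul_nonneg (Real.exp_pos _).le (hk0 r hr))]
      refine mul_le_of_le_one_left (hk0 r hr) (Real.exp_le_one_iff.mpr ?_)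
      have : 0 < r := hr
      nlinarith
    have hbound : ‖conv K (fun τ => G' τ - G τ) t‖ ≤
        ∫ r in Set.Ioi (0 : ℝ), (L * c * Real.exp (γ * t)) * (Real.exp (-γ * r) * k r) := by
      refine norm_integral_le_of_norm_le (hint.const_mul _) ?_
      refine (ae_restrict_iff' measurableSet_Ioi).mpr (ae_of_all _ fun r hr => ?_)
      have hr0 : 0 < r := hr
      by_cases hrt : r < t
      · rw [Set.indicator_of_mem (show r ∈ Set.Iio t from hrt)]
        refine ((K r).le_opNorm _).trans ?_
        have h1 : ‖G' (t - r) - G (t - r)‖ ≤ L * (c * Real.exp (γ * (t - r))) := by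
          rw [norm_sub_rev]
          refine (hLip _ (by linarith)).trans ?_
          gcongr
          exact hc _ (by linarith)
        have h2 : Real.exp (γ * (t - r)) = Real.exp (γ * t) * Real.exp (-γ * r) := by
          rw [← Real.exp_add]
          congr 1
          ring
        rw [h2] at h1
        calc ‖K r‖ * ‖G' (t - r) - G (t - r)‖
            ≤ k r * (L * (c * (Real.exp (γ * t) * Real.exp (-γ * r)))) :=
              mul_le_mul (h.bound r hr0) h1 (norm_nonneg _) (hk0 r hr)
          _ = _ := by ring
      · rw [Set.indicator_of_notMem (show r ∉ Set.Iio t from hrt), norm_zero]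
        have := hk0 r hr
        positivity
    rw [integral_const_mul] at hbound
    rw [hV t ht, hV' t ht, sub_sub_sub_cancel_left, h.conv_sub hG' hM' hG hM]
    refine hbound.trans ?_
    have h3 : 0 ≤ c * Real.exp (γ * t) := by positivity
    nlinarith [mul_le_mul_of_nonneg_left hγ1 h3]
  have hpow : ∀ n : ℕ, ∀ t, 0 ≤ t → ‖V t - V' t‖ ≤ D * (1 / 2) ^ n * Real.exp (γ * t) := by
    intro n
    induction n with
    | zero =>
      intro t ht
      have hD0 : 0 ≤ D := (norm_nonneg _).trans (hD 0 le_rfl)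
      rw [pow_zero, mul_one]
      refine (hD t ht).trans (le_mul_of_one_le_right hD0 (Real.one_le_exp (by positivity)))
    | succ n ih =>
      intro t ht
      refine (step _ ih t ht).trans_eq ?_
      rw [pow_succ]
      ring
  intro t ht
  rw [← sub_eq_zero, ← norm_le_zero_iff]
  have hl : Tendsto (fun n : ℕ => D * (1 / 2) ^ n * Real.exp (γ * t)) atTop
      (𝓝 (D * 0 * Real.exp (γ * t))) :=
    ((tendsto_pow_atTop_nhds_zero_of_lt_one (by norm_num) (by norm_num)).const_mul D).mul_const _
  rw [mul_zero, zero_mul] at hl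
  exact ge_of_tendsto' hl fun n => hpow n t ht

end Mild

/-! ### The heat flow on zero-average fields and its smoothing -/

section Heat

variable {d n : ℕ}

open Classical in
/-- The symbol of `e^{t(Δ + a)}` on the functions with zero average. -/
def heatSymbol (a t : ℝ) (ξ : Fin d → ℤ) : ℝ :=
  if ξ = 0 then 0 else Real.exp (-(freqSq ξ - a) * t)

/-- The symbol of `⟨D⟩ e^{t(Δ + a)}` on the functions with zero average. -/
def derivHeatSymbol (a t : ℝ) (ξ : Fin d → ℤ) : ℝ := bracket ξ * heatSymbol a t ξ

theorem heatSymbol_zero_freq (a t : ℝ) : heatSymbol a t (0 : Fin d → ℤ) = 0 := if_pos rfl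

theorem heatSymbol_of_ne (a t : ℝ) {ξ : Fin d → ℤ} (h : ξ ≠ 0) :
    heatSymbol a t ξ = Real.exp (-(freqSq ξ - a) * t) := if_neg h

theorem heatSymbol_nonneg (a t : ℝ) (ξ : Fin d → ℤ) : 0 ≤ heatSymbol a t ξ := by
  unfold heatSymbol
  split_ifs
  exacts [le_rfl, (Real.exp_pos _).le]

theorem heatSymbol_neg (a t : ℝ) (ξ : Fin d → ℤ) : heatSymbol a t (-ξ) = heatSymbol a t ξ := by
  simp only [heatSymbol, neg_eq_zero, freqSq_neg]

/-- The algebra behind the substitution `V = e^{-αt}W`. -/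
theorem heatSymbol_eq (a t : ℝ) (ξ : Fin d → ℤ) :
    heatSymbol a t ξ = Real.exp (a * t) * heatSymbol 0 t ξ := by
  unfold heatSymbol
  split_ifs
  · rw [mul_zero]
  · rw [← Real.exp_add]
    congr 1
    ring

theorem continuous_heatSymbol (a : ℝ) (ξ : Fin d → ℤ) : Continuous fun t => heatSymbol a t ξ := by
  unfold heatSymbol
  split_ifs
  · exact continuous_const
  · fun_prop

theorem abs_heatSymbol_le {a t : ℝ} (ha : a ≤ 1) (ht : 0 ≤ t) (ξ : Fin d → ℤ) :
    |heatSymbol a t ξ| ≤ 1 := by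
  rw [abs_of_nonneg (heatSymbol_nonneg a t ξ)]
  by_cases h : ξ = 0
  · rw [h, heatSymbol_zero_freq]
    exact zero_le_one
  · rw [heatSymbol_of_ne a t h, Real.exp_le_one_iff]
    have := one_le_freqSq h
    nlinarith

theorem isSymbol_heatSymbol {a t : ℝ} (ha : a ≤ 1) (ht : 0 ≤ t) :
    IsSymbol (heatSymbol a t : (Fin d → ℤ) → ℝ) :=
  ⟨heatSymbol_neg a t, 1, abs_heatSymbol_le ha ht⟩

/-- A dominating function for the norm of `⟨D⟩ e^{t(Δ + a)}`. -/
def heatBound (a r : ℝ) : ℝ :=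
  ((1 - a) / 2) ^ (-(1 / 2) : ℝ) * (r ^ (-(1 / 2) : ℝ) * Real.exp (-((1 - a) / 2) * r))

theorem integrableOn_heatBound {a : ℝ} (ha : a < 1) : IntegrableOn (heatBound a) (Set.Ioi 0) := by
  have h := integrableOn_rpow_mul_exp_neg_mul_rpow (s := -(1 / 2)) (p := 1) (b := (1 - a) / 2)
    (by norm_num) one_pos (by linarith)
  simp only [Real.rpow_one] at h
  exact h.const_mul _

theorem sqrt_mul_exp_neg_le (x : ℝ) (hx : 0 ≤ x) : Real.sqrt x * Real.exp (-x) ≤ 1 := by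
  rw [Real.exp_neg, ← div_eq_mul_inv, div_le_one (Real.exp_pos x)]
  have h1 : Real.sqrt x ≤ x + 1 := by
    rw [Real.sqrt_le_left (by linarith)]
    nlinarith
  exact h1.trans (Real.add_one_le_exp x)

theorem abs_derivHeatSymbol_le {a r : ℝ} (ha0 : 0 ≤ a) (ha : a < 1) (hr : 0 < r)
    (ξ : Fin d → ℤ) : |derivHeatSymbol a r ξ| ≤ heatBound a r := by
  have hc : 0 < (1 - a) / 2 := by linarith
  rw [derivHeatSymbol, abs_of_nonneg (mul_nonneg (bracket_pos ξ).le (heatSymbol_nonneg a r ξ))]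
  by_cases h : ξ = 0
  · rw [h, heatSymbol_zero_freq, mul_zero]
    unfold heatBound
    positivity
  · have h1 := one_le_freqSq h
    set c := (1 - a) / 2 with hc'
    -- As `|ξ|² ≥ 1`, one has `|ξ|² - a ≥ c|ξ|² + c` with `c = (1 - a)/2`. The first part pays for
    -- the derivative through `√x e^{-x} ≤ 1` at `x = cr|ξ|²`, leaving `(cr)^{-1/2}`; the second
    -- gives decay in time.
    have e1 : -(freqSq ξ - a) * r ≤ -(c * r * freqSq ξ) + -c * r := by
      have : c * freqSq ξ + c ≤ freqSq ξ - a := by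
        rw [hc']
        nlinarith
      nlinarith
    have e2 : bracket ξ = Real.sqrt (c * r * freqSq ξ) * (c * r) ^ (-(1 / 2) : ℝ) := by
      rw [← bracket_sq_of_ne h, Real.sqrt_mul (by positivity), Real.sqrt_sq (bracket_pos ξ).le,
        Real.sqrt_eq_rpow, mul_right_comm, ← Real.rpow_add (by positivity)]
      norm_num
    rw [heatSymbol_of_ne a r h]
    calc bracket ξ * Real.exp (-(freqSq ξ - a) * r)
        ≤ bracket ξ * Real.exp (-(c * r * freqSq ξ) + -c * r) := by
          have := bracket_pos ξ
          gcongr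
      _ = (Real.sqrt (c * r * freqSq ξ) * Real.exp (-(c * r * freqSq ξ))) *
          ((c * r) ^ (-(1 / 2) : ℝ) * Real.exp (-c * r)) := by
          rw [Real.exp_add]
          nth_rw 1 [e2]
          ring
      _ ≤ 1 * ((c * r) ^ (-(1 / 2) : ℝ) * Real.exp (-c * r)) := by
          have := freqSq_nonneg ξ
          gcongr
          exact sqrt_mul_exp_neg_le _ (by positivity)
      _ = heatBound a r := by
          rw [heatBound, Real.mul_rpow hc.le hr.le]
          ring

theorem isSymbol_derivHeatSymbol {a r : ℝ} (ha0 : 0 ≤ a) (ha : a < 1) (hr : 0 < r) :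
    IsSymbol (derivHeatSymbol a r : (Fin d → ℤ) → ℝ) :=
  ⟨fun ξ => by rw [derivHeatSymbol, bracket_neg, heatSymbol_neg, derivHeatSymbol], _,
    abs_derivHeatSymbol_le ha0 ha hr⟩

/-- The operator `⟨D⟩ e^{r(Δ + a)}`. -/
def derivHeat (a r : ℝ) : L2 d n →L[ℝ] L2 d n := mult (derivHeatSymbol a r)

theorem heatBound_nonneg {a r : ℝ} (ha : a < 1) (hr : 0 < r) : 0 ≤ heatBound a r := by
  have : 0 < (1 - a) / 2 := by linarith
  unfold heatBound
  positivity

theorem isKernel_derivHeat {a : ℝ} (ha0 : 0 ≤ a) (ha : a < 1) :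
    IsKernel (derivHeat a : ℝ → L2 d n →L[ℝ] L2 d n) (heatBound a) where
  integrable := integrableOn_heatBound ha
  bound r hr := norm_mult_le (isSymbol_derivHeatSymbol ha0 ha hr) (heatBound_nonneg ha hr)
    (abs_derivHeatSymbol_le ha0 ha hr)
  cont := by
    rintro ⟨r₀, x₀⟩ ⟨hr₀, -⟩
    have hr₀ : 0 < r₀ := hr₀
    refine ContinuousAt.continuousWithinAt ?_
    have hcb : ContinuousAt (heatBound a) r₀ := by
      unfold heatBound
      refine continuousAt_const.mul (ContinuousAt.mul ?_ (by fun_prop))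
      exact Real.continuousAt_rpow_const _ _ (Or.inl hr₀.ne')
    have hpos : ∀ᶠ r in 𝓝 r₀, 0 < r := lt_mem_nhds hr₀
    have hM : ∀ᶠ r in 𝓝 r₀, heatBound a r ≤ heatBound a r₀ + 1 :=
      (hcb.eventually (gt_mem_nhds (lt_add_one _))).mono fun r hr => le_of_lt hr
    -- Joint continuity follows from strong continuity at the fixed vector `x₀` together with a
    -- bound on the operator norms for `r` near `r₀`, used on `p.2 - x₀`.
    have h1 : Tendsto (fun r => derivHeat a r x₀) (𝓝 r₀) (𝓝 (derivHeat a r₀ x₀)) := by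
      refine tendsto_mult (M := heatBound a r₀ + 1) (hpos.mono fun r hr =>
        isSymbol_derivHeatSymbol ha0 ha hr) (isSymbol_derivHeatSymbol ha0 ha hr₀) ?_ ?_ x₀
      · filter_upwards [hpos, hM] with r hr hr2 ξ
        exact (abs_derivHeatSymbol_le ha0 ha hr ξ).trans hr2
      · intro ξ
        exact ((continuous_heatSymbol a ξ).const_mul _).continuousAt.tendsto
    have h2 : Tendsto (fun p : ℝ × L2 d n => derivHeat a p.1 (p.2 - x₀)) (𝓝 (r₀, x₀)) (𝓝 0) := by
      refine squeeze_zero_norm' (a := fun p => (heatBound a r₀ + 1) * ‖p.2 - x₀‖) ?_ ?_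
      · rw [nhds_prod_eq]
        filter_upwards [(hpos.and hM).prod_inl (𝓝 x₀)] with p hp
        refine (ContinuousLinearMap.le_opNorm _ _).trans ?_
        gcongr
        exact (norm_mult_le (isSymbol_derivHeatSymbol ha0 ha hp.1) (heatBound_nonneg ha hp.1)
          (abs_derivHeatSymbol_le ha0 ha hp.1)).trans hp.2
      · have : Continuous fun p : ℝ × L2 d n => (heatBound a r₀ + 1) * ‖p.2 - x₀‖ := by fun_prop
        simpa using this.tendsto (r₀, x₀)
    have h3 := (h1.comp (continuous_fst.tendsto (r₀, x₀))).add h2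
    rw [add_zero] at h3
    refine h3.congr fun p => ?_
    simp only [Function.comp, map_sub]
    abel

theorem coeff_conv {a : ℝ} (ha0 : 0 ≤ a) (ha : a < 1) {G : ℝ → L2 d n} {M : ℝ} (hG : Continuous G)
    (hM : ∀ τ, ‖G τ‖ ≤ M) {t : ℝ} (ht : 0 ≤ t) (ξ : Fin d → ℤ) :
    coeff (conv (derivHeat a) G t) ξ =
      ∫ τ in (0 : ℝ)..t, derivHeatSymbol a (t - τ) ξ • coeff (G τ) ξ := by
  have hK := isKernel_derivHeat (d := d) (n := n) ha0 ha
  rw [← coeffL_apply, conv, ← ContinuousLinearMap.integral_comp_comm _ (hK.integrable_conv hG hM t)]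
  have e1 : ∀ r, coeffL ξ ((Set.Iio t).indicator (fun r => derivHeat a r (G (t - r))) r) =
      (Set.Iio t).indicator (fun r => coeffL ξ (derivHeat a r (G (t - r)))) r := by
    intro r
    by_cases hr : r ∈ Set.Iio t
    · rw [Set.indicator_of_mem hr, Set.indicator_of_mem hr]
    · rw [Set.indicator_of_notMem hr, Set.indicator_of_notMem hr, map_zero]
  simp only [e1]
  rw [setIntegral_indicator measurableSet_Iio, Set.Ioi_inter_Iio, ← integral_Ioc_eq_integral_Ioo,
    ← intervalIntegral.integral_of_le ht]
  -- `r` is written as `t - (t - r)` to expose the substitution `τ = t - r`.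
  have e2 : ∫ r in (0 : ℝ)..t, coeffL ξ (derivHeat a r (G (t - r))) =
      ∫ r in (0 : ℝ)..t, derivHeatSymbol a (t - (t - r)) ξ • coeff (G (t - r)) ξ := by
    rw [intervalIntegral.integral_of_le ht, intervalIntegral.integral_of_le ht]
    refine setIntegral_congr_fun measurableSet_Ioc fun r hr => ?_
    simp only [sub_sub_cancel]
    exact coeff_mult (isSymbol_derivHeatSymbol ha0 ha hr.1) _ ξ
  rw [e2, intervalIntegral.integral_comp_sub_left
    (fun τ => derivHeatSymbol a (t - τ) ξ • coeff (G τ) ξ)]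
  simp

end Heat

/-! ### Duhamel's formula for a scalar rate -/

section Duhamel

variable {F : Type*} [NormedAddCommGroup F] [NormedSpace ℝ F]

theorem hasDerivAt_duhamel [CompleteSpace F] {l : ℝ} {g : ℝ → F} (hg : Continuous g) (z₀ : F) (t : ℝ) :
    HasDerivAt (fun t => Real.exp (-l * t) • (z₀ - ∫ τ in (0 : ℝ)..t, Real.exp (l * τ) • g τ))
      (-l • (Real.exp (-l * t) • (z₀ - ∫ τ in (0 : ℝ)..t, Real.exp (l * τ) • g τ)) - g t) t := by
  have h1 : HasDerivAt (fun t => Real.exp (-l * t)) (Real.exp (-l * t) * (-l * 1)) t :=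
    ((hasDerivAt_id t).const_mul (-l)).exp
  have hc : Continuous fun τ => Real.exp (l * τ) • g τ := by fun_prop
  have h2 : HasDerivAt (fun t => z₀ - ∫ τ in (0 : ℝ)..t, Real.exp (l * τ) • g τ)
      (-(Real.exp (l * t) • g t)) t := (hc.integral_hasStrictDerivAt 0 t).hasDerivAt.const_sub z₀
  have h3 := h1.smul h2
  convert! h3 using 1
  rw [smul_neg, smul_smul, smul_smul, ← Real.exp_add,
    show -l * t + l * t = 0 by ring, Real.exp_zero, one_smul, sub_eq_neg_add]
  congr 2
  ring

theorem duhamel_eq {l : ℝ} (g : ℝ → F) (z₀ : F) (t : ℝ) :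
    Real.exp (-l * t) • (z₀ - ∫ τ in (0 : ℝ)..t, Real.exp (l * τ) • g τ) =
      Real.exp (-l * t) • z₀ - ∫ τ in (0 : ℝ)..t, Real.exp (-l * (t - τ)) • g τ := by
  rw [smul_sub, ← intervalIntegral.integral_smul]
  congr 2
  ext τ
  rw [smul_smul, ← Real.exp_add]
  congr 2
  ring

/-- The integrated form of a linear equation, from Duhamel's formula. -/
theorem integral_eq_of_duhamel [CompleteSpace F] {l : ℝ} {g z : ℝ → F} (hg : Continuous g) {z₀ : F}
    (hz : ∀ t, 0 ≤ t → z t = Real.exp (-l * t) • z₀ -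
      ∫ τ in (0 : ℝ)..t, Real.exp (-l * (t - τ)) • g τ) {t : ℝ} (ht : 0 ≤ t) :
    z t = z 0 + ∫ τ in (0 : ℝ)..t, (-l • z τ - g τ) := by
  -- `w` extends `z` to the whole line and is differentiable there, so no one-sided derivative is
  -- needed at 0.
  let w : ℝ → F := fun t =>
    Real.exp (-l * t) • (z₀ - ∫ τ in (0 : ℝ)..t, Real.exp (l * τ) • g τ)
  have hzw : ∀ t, 0 ≤ t → z t = w t := fun t ht => (hz t ht).trans (duhamel_eq g z₀ t).symm
  have hw : ∀ t, HasDerivAt w (-l • w t - g t) t := hasDerivAt_duhamel hg z₀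
  have hwc : Continuous w := continuous_iff_continuousAt.mpr fun t => (hw t).continuousAt
  have h1 : ∫ τ in (0 : ℝ)..t, (-l • z τ - g τ) = ∫ τ in (0 : ℝ)..t, (-l • w τ - g τ) := by
    refine intervalIntegral.integral_congr fun τ hτ => ?_
    rw [Set.uIcc_of_le ht] at hτ
    simp only [hzw τ hτ.1]
  rw [h1, intervalIntegral.integral_eq_sub_of_hasDerivAt (fun τ _ => hw τ)
    (((hwc.const_smul (-l)).sub hg).intervalIntegrable _ _), hzw t ht, hzw 0 le_rfl]
  abel

/-- **Duhamel**'s formula. -/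
theorem duhamel_of_hasDerivWithinAt [CompleteSpace F] {l : ℝ} {g z : ℝ → F} (hg : Continuous g)
    (hz : ∀ t, 0 ≤ t → HasDerivWithinAt z (-l • z t - g t) (Set.Ici 0) t) {t : ℝ} (ht : 0 ≤ t) :
    z t = Real.exp (-l * t) • z 0 - ∫ τ in (0 : ℝ)..t, Real.exp (-l * (t - τ)) • g τ := by
  -- The integrating factor `e^{lτ}` removes the linear term.
  have hw : ∀ τ, 0 ≤ τ → HasDerivWithinAt (fun τ => Real.exp (l * τ) • z τ)
      (-(Real.exp (l * τ) • g τ)) (Set.Ici 0) τ := by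
    intro τ hτ
    have h1 : HasDerivWithinAt (fun t => Real.exp (l * t)) (Real.exp (l * τ) * (l * 1))
        (Set.Ici 0) τ := (((hasDerivAt_id τ).const_mul l).exp).hasDerivWithinAt
    have h2 := h1.smul (hz τ hτ)
    convert! h2 using 1
    rw [smul_sub, smul_smul, mul_one, mul_neg, neg_smul, sub_eq_neg_add, neg_add_cancel_right]
  have h1 := intervalIntegral.integral_eq_sub_of_hasDeriv_right_of_le ht
    (fun τ hτ => ((hw τ hτ.1).continuousWithinAt.mono Set.Icc_subset_Ici_self))
    (fun τ hτ => (hw τ hτ.1.le).mono fun x hx => (hτ.1.trans hx).le)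
    (by
      have : Continuous fun τ => -(Real.exp (l * τ) • g τ) := by fun_prop
      exact this.intervalIntegrable _ _)
  rw [intervalIntegral.integral_neg, mul_zero, Real.exp_zero, one_smul] at h1
  rw [← duhamel_eq, sub_eq_add_neg, h1, add_sub_cancel, smul_smul, ← Real.exp_add, neg_mul,
    neg_add_cancel, Real.exp_zero, one_smul]

end Duhamel

/-! ### Curves in `H^σ` and their lifts to `L²` -/

section Curves

variable {d n : ℕ} {σ : ℝ}

theorem hsNorm_smooth_sub (hσ : 0 ≤ σ) (V W : L2 d n) :
    hsNorm σ (smooth σ V - smooth σ W) = (Real.sqrt (torusVol d))⁻¹ * ‖V - W‖ := by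
  rw [← map_sub, hsNorm_smooth hσ]

theorem inv_sqrt_torusVol_pos (d : ℕ) : 0 < (Real.sqrt (torusVol d))⁻¹ :=
  inv_pos.mpr (Real.sqrt_pos.mpr (torusVol_pos d))

theorem contBddHs_smooth {X : Type*} [TopologicalSpace X] {A : Set X} (hσ : 0 ≤ σ)
    {V : X → L2 d n} (hV : ContinuousOn V A) {M : ℝ} (hM : ∀ t ∈ A, ‖V t‖ ≤ M) :
    ContBddHs σ A fun t => smooth σ (V t) := by
  refine ⟨⟨fun t _ => memHs_smooth hσ _, fun t ht => ?_⟩, (Real.sqrt (torusVol d))⁻¹ * M,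
    fun t ht => ?_⟩
  · simp only [hsNorm_smooth_sub hσ]
    have h := (tendsto_iff_norm_sub_tendsto_zero.mp (hV t ht)).const_mul
      (Real.sqrt (torusVol d))⁻¹
    rwa [mul_zero] at h
  · rw [hsNorm_smooth hσ]
    exact mul_le_mul_of_nonneg_left (hM t ht) (inv_sqrt_torusVol_pos d).le

theorem ContHs.exists_smooth {X : Type*} [TopologicalSpace X] {A : Set X} (hσ : 0 ≤ σ)
    {v : X → L2 d n} (hv : ContHs σ A v) :
    ∃ V : X → L2 d n, (∀ t ∈ A, smooth σ (V t) = v t) ∧ ContinuousOn V A := by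
  classical
  have h : ∀ t, ∃ V : L2 d n, t ∈ A → smooth σ V = v t := fun t => by
    by_cases ht : t ∈ A
    · obtain ⟨V, hV⟩ := (hv.1 t ht).exists_smooth hσ
      exact ⟨V, fun _ => hV⟩
    · exact ⟨0, fun h => absurd h ht⟩
  choose V hV using h
  refine ⟨V, hV, fun t ht => tendsto_iff_norm_sub_tendsto_zero.mpr ?_⟩
  have h1 := (hv.2 t ht).const_mul (Real.sqrt (torusVol d))
  rw [mul_zero] at h1
  refine h1.congr' ?_
  filter_upwards [self_mem_nhdsWithin] with τ hτ
  rw [← hV t ht, ← hV τ hτ, hsNorm_smooth_sub hσ,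
    mul_inv_cancel_left₀ (Real.sqrt_pos.mpr (torusVol_pos d)).ne']

theorem hasTimeDeriv_smooth {I : Set ℝ} (hσ : 0 ≤ σ) {Z : ℝ → L2 d n} {W : L2 d n} {t : ℝ}
    (h : HasDerivWithinAt Z W I t) : HasTimeDeriv σ I (fun t => smooth σ (Z t)) (smooth σ W) t := by
  refine ⟨fun _ _ => memHs_smooth hσ _, memHs_smooth hσ _, ?_⟩
  have h1 := (tendsto_iff_norm_sub_tendsto_zero.mp
    (hasDerivWithinAt_iff_tendsto_slope.mp h)).const_mul (Real.sqrt (torusVol d))⁻¹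
  rw [mul_zero] at h1
  refine h1.congr fun τ => ?_
  rw [← map_sub, ← map_smul, hsNorm_smooth_sub hσ, slope_def_module]

/-- Each Fourier coefficient is dominated by the `H^σ` norm, so a derivative in `H^σ` gives a
derivative of every coefficient. -/
theorem HasTimeDeriv.coeff {I : Set ℝ} (hσ : 0 ≤ σ) {v : ℝ → L2 d n} {w : L2 d n} {t : ℝ}
    (h : HasTimeDeriv σ I v w t) (ht : t ∈ I) (ξ : Fin d → ℤ) :
    HasDerivWithinAt (fun τ => coeff (v τ) ξ) (coeff w ξ) I t := by
  rw [hasDerivWithinAt_iff_tendsto_slope, tendsto_iff_norm_sub_tendsto_zero]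
  refine squeeze_zero' (Eventually.of_forall fun _ => norm_nonneg _) ?_ h.2.2
  filter_upwards [self_mem_nhdsWithin] with τ hτ
  rw [slope_def_module, ← coeff_sub, ← coeff_smul, ← coeff_sub]
  exact norm_coeff_le_hsNorm hσ
    ((((h.1 τ hτ.1).sub hσ (h.1 t ht)).smul hσ _).sub hσ h.2.1) ξ

end Curves

/-! ### Equivalence of the classical and the integral equation -/

section Perturbation

variable {d : ℕ} {s : ℝ}

/-- The symbol of `Δ ⟨D⟩^{-2}`. -/
def lapSymbol (ξ : Fin d → ℤ) : ℝ := -freqSq ξ * bracket ξ ^ (-2 : ℝ)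

theorem abs_lapSymbol_le (ξ : Fin d → ℤ) : |lapSymbol ξ| ≤ 1 := by
  rw [lapSymbol, neg_mul, abs_neg, abs_of_nonneg (mul_nonneg (freqSq_nonneg ξ)
    (Real.rpow_nonneg (bracket_pos ξ).le _)), Real.rpow_neg (bracket_pos ξ).le, Real.rpow_two,
    ← div_eq_mul_inv, div_le_one (by have := bracket_pos ξ; positivity)]
  exact freqSq_le_bracket_sq ξ

theorem isSymbol_lapSymbol : IsSymbol (lapSymbol : (Fin d → ℤ) → ℝ) :=
  ⟨fun ξ => by rw [lapSymbol, freqSq_neg, bracket_neg, lapSymbol], 1, abs_lapSymbol_le⟩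

theorem lap_smooth (hs : 2 ≤ s) (V : L2 d d) :
    lap (smooth s V) = smooth (s - 2) (mult lapSymbol V) := by
  refine ext_coeff fun ξ => ?_
  rw [coeff_lap ((memHs_smooth (by linarith) V).mono hs), coeff_smooth (by linarith),
    coeff_smooth (by linarith), coeff_mult isSymbol_lapSymbol, smul_smul, smul_smul, lapSymbol,
    mul_left_comm, ← Real.rpow_add (bracket_pos ξ)]
  congr 3
  ring

/-- The nonlinear terms of the perturbation equation. -/
def forcing (N : L2 d d →L[ℝ] L2 d d →L[ℝ] L2 d d) (U V : L2 d d) : L2 d d :=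
  N U V + N V U + N V V

theorem continuous_forcing (N : L2 d d →L[ℝ] L2 d d →L[ℝ] L2 d d) {U V : ℝ → L2 d d}
    (hU : Continuous U) (hV : Continuous V) : Continuous fun t => forcing N (U t) (V t) :=
  (((N.continuous.comp hU).clm_apply hV).add ((N.continuous.comp hV).clm_apply hU)).add
    ((N.continuous.comp hV).clm_apply hV)

theorem norm_forcing_le (N : L2 d d →L[ℝ] L2 d d →L[ℝ] L2 d d) {U V : L2 d d} {ρ : ℝ}
    (hU : ‖U‖ ≤ ρ) : ‖forcing N U V‖ ≤ ‖N‖ * (2 * ρ + ‖V‖) * ‖V‖ := by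
  have h1 := N.le_opNorm₂ U V
  have h2 := N.le_opNorm₂ V U
  have h3 := N.le_opNorm₂ V V
  have h4 : ‖N‖ * ‖V‖ * ‖U‖ ≤ ‖N‖ * ‖V‖ * ρ := by gcongr
  have h5 := norm_add_le (N U V + N V U) (N V V)
  have h6 := norm_add_le (N U V) (N V U)
  unfold forcing
  nlinarith

theorem norm_forcing_sub_le (N : L2 d d →L[ℝ] L2 d d →L[ℝ] L2 d d) {U V V' : L2 d d} {ρ M : ℝ}
    (hU : ‖U‖ ≤ ρ) (hV : ‖V‖ ≤ M) (hV' : ‖V'‖ ≤ M) :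
    ‖forcing N U V - forcing N U V'‖ ≤ ‖N‖ * (2 * ρ + 2 * M) * ‖V - V'‖ := by
  have e : forcing N U V - forcing N U V' =
      N U (V - V') + N (V - V') U + N V (V - V') + N (V - V') V' := by
    simp only [forcing, map_sub, sub_apply]
    abel
  have h1 := N.le_opNorm₂ U (V - V')
  have h2 := N.le_opNorm₂ (V - V') U
  have h3 := N.le_opNorm₂ V (V - V')
  have h4 := N.le_opNorm₂ (V - V') V'
  have hN : 0 ≤ ‖N‖ * ‖V - V'‖ := by positivity
  have h5 := mul_le_mul_of_nonneg_left hU hN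
  have h6 := mul_le_mul_of_nonneg_left hV hN
  have h7 := mul_le_mul_of_nonneg_left hV' hN
  rw [e]
  have h8 := norm_add_le (N U (V - V') + N (V - V') U + N V (V - V')) (N (V - V') V')
  have h9 := norm_add_le (N U (V - V') + N (V - V') U) (N V (V - V'))
  have h10 := norm_add_le (N U (V - V')) (N (V - V') U)
  nlinarith

variable {N : L2 d d →L[ℝ] L2 d d →L[ℝ] L2 d d}

theorem smooth_forcing
    (hN : ∀ A B, smooth (s - 1) (N A B) = leray (advect (smooth s A) (smooth s B)))
    (U V : L2 d d) : smooth (s - 1) (forcing N U V) =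
      leray (advect (smooth s U) (smooth s V) + advect (smooth s V) (smooth s U) +
        advect (smooth s V) (smooth s V)) := by
  simp only [forcing, map_add, hN]

theorem forcing_mem_divFree (hs : 1 ≤ s)
    (hN : ∀ A B, smooth (s - 1) (N A B) = leray (advect (smooth s A) (smooth s B)))
    (U V : L2 d d) : forcing N U V ∈ divFree d := by
  rw [← smooth_mem_divFree_iff (sub_nonneg.mpr hs), smooth_forcing hN]
  exact leray_mem _

theorem coeff_zero_forcing (hs : (d : ℝ) / 2 + 1 < s)
    (hN : ∀ A B, smooth (s - 1) (N A B) = leray (advect (smooth s A) (smooth s B)))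
    {U V : L2 d d} (hU : U ∈ divFree d) (hV : V ∈ divFree d) : coeff (forcing N U V) 0 = 0 := by
  have hs1 : 0 ≤ s - 1 := by
    have : (0 : ℝ) ≤ d := by positivity
    linarith
  have h : coeff (smooth (s - 1) (forcing N U V)) 0 = 0 := by
    rw [smooth_forcing hN, map_add, map_add, coeff_add, coeff_add,
      coeff_zero_leray_advect hs hU, coeff_zero_leray_advect hs hV, coeff_zero_leray_advect hs hV]
    simp
  rw [coeff_smooth hs1] at h
  exact (smul_eq_zero.mp h).resolve_left (Real.rpow_pos_of_pos (bracket_pos _) _).ne'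

/-- The time derivative of `⟨D⟩^{-2} V`. -/
def timeDeriv (N : L2 d d →L[ℝ] L2 d d →L[ℝ] L2 d d) (U V : L2 d d) : L2 d d :=
  mult lapSymbol V - smooth 1 (forcing N U V)

theorem norm_timeDeriv_le (N : L2 d d →L[ℝ] L2 d d →L[ℝ] L2 d d) {U V : L2 d d} {ρ : ℝ}
    (hU : ‖U‖ ≤ ρ) : ‖timeDeriv N U V‖ ≤ (1 + ‖N‖ * (2 * ρ + ‖V‖)) * ‖V‖ := by
  have h1 : ‖mult lapSymbol V‖ ≤ 1 * ‖V‖ :=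
    (ContinuousLinearMap.le_opNorm _ _).trans (mul_le_mul_of_nonneg_right
      (norm_mult_le isSymbol_lapSymbol zero_le_one abs_lapSymbol_le) (norm_nonneg _))
  have h2 := norm_smooth_apply_le zero_le_one (forcing N U V)
  have h3 := norm_forcing_le N (V := V) hU
  have h4 := norm_sub_le (mult lapSymbol V) (smooth 1 (forcing N U V))
  unfold timeDeriv
  linarith

theorem coeff_conv_derivHeat {G : ℝ → L2 d d} {M : ℝ} (hG : Continuous G)
    (hM : ∀ τ, ‖G τ‖ ≤ M) {t : ℝ} (ht : 0 ≤ t) {ξ : Fin d → ℤ} (hξ : ξ ≠ 0) :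
    coeff (conv (derivHeat 0) G t) ξ =
      ∫ τ in (0 : ℝ)..t, Real.exp (-freqSq ξ * (t - τ)) • (bracket ξ • coeff (G τ) ξ) := by
  rw [coeff_conv le_rfl one_pos hG hM ht]
  congr 1
  ext1 τ
  rw [derivHeatSymbol, heatSymbol_of_ne _ _ hξ, sub_zero, smul_smul, mul_comm]

theorem continuous_smul_coeff {G : ℝ → L2 d d} (hG : Continuous G) (c : ℝ) (ξ : Fin d → ℤ) :
    Continuous fun τ => c • coeff (G τ) ξ :=
  (continuous_const_smul c).comp ((coeffL ξ).continuous.comp hG)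

/-- A solution of the integral equation is a classical solution. -/
theorem isPerturbationSolution_of_mild (hd : 2 ≤ d) (hs : (d : ℝ) / 2 + 1 < s)
    (hN : ∀ A B, smooth (s - 1) (N A B) = leray (advect (smooth s A) (smooth s B)))
    {U V : ℝ → L2 d d} {V₀ : L2 d d} {ρ M : ℝ} (hU : Continuous U) (hUρ : ∀ t, ‖U t‖ ≤ ρ)
    (hUdiv : ∀ t, U t ∈ divFree d) (hV : Continuous V) (hVM : ∀ t, ‖V t‖ ≤ M)
    (hV₀ : V₀ ∈ divFree d) (hV₀m : coeff V₀ 0 = 0)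
    (hmild : ∀ t, 0 ≤ t → V t = mult (heatSymbol 0 t) V₀ -
      conv (derivHeat 0) (fun τ => forcing N (U τ) (V τ)) t) :
    IsPerturbationSolution s (fun t => smooth s (U t)) (smooth s V₀) (fun t => smooth s (V t))
      (fun t => smooth (s - 2) (timeDeriv N (U t) (V t))) := by
  have hs2 : 2 < s := by
    have : (2 : ℝ) ≤ d := by exact_mod_cast hd
    linarith
  have hs0 : 0 ≤ s := by linarith
  have hσ : 0 ≤ s - 2 := by linarith
  have hρ0 : 0 ≤ ρ := (norm_nonneg _).trans (hUρ 0)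
  have hM0 : 0 ≤ M := (norm_nonneg _).trans (hVM 0)
  set G : ℝ → L2 d d := fun τ => forcing N (U τ) (V τ) with hGdef
  have hG : Continuous G := continuous_forcing N hU hV
  have hGM : ∀ τ, ‖G τ‖ ≤ ‖N‖ * (2 * ρ + M) * M := fun τ => by
    refine (norm_forcing_le N (hUρ τ)).trans ?_
    have := hVM τ
    gcongr
  have hK : IsKernel (derivHeat 0 : ℝ → L2 d d →L[ℝ] L2 d d) (heatBound 0) :=
    isKernel_derivHeat le_rfl one_pos
  have hdiv : ∀ t, 0 ≤ t → V t ∈ divFree d := by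
    intro t ht
    -- `leray` passes under the integral, commutes with the heat multipliers, and fixes both `V₀`
    -- and the forcing.
    have h1 : leray (V t) = V t := by
      rw [hmild t ht, map_sub, leray_mult (isSymbol_heatSymbol zero_le_one ht), leray_eq_self hV₀,
        conv, ← ContinuousLinearMap.integral_comp_comm _ (hK.integrable_conv hG hGM t)]
      congr 1
      refine setIntegral_congr_fun measurableSet_Ioi fun r hr => ?_
      by_cases hrt : r ∈ Set.Iio t
      · simp only [Set.indicator_of_mem hrt]
        rw [derivHeat, leray_mult (isSymbol_derivHeatSymbol le_rfl one_pos hr),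
          leray_eq_self (forcing_mem_divFree (by linarith) hN _ _)]
      · simp only [Set.indicator_of_notMem hrt, map_zero]
    rw [← h1]
    exact leray_mem _
  have hmean : ∀ t, 0 ≤ t → coeff (V t) 0 = 0 := by
    intro t ht
    rw [hmild t ht, coeff_sub, coeff_mult (isSymbol_heatSymbol zero_le_one ht),
      coeff_conv le_rfl one_pos hG hGM ht]
    simp [derivHeatSymbol, heatSymbol_zero_freq]
  have hmean' : ∀ t, 0 ≤ t → coeff (timeDeriv N (U t) (V t)) 0 = 0 := by
    intro t ht
    rw [timeDeriv, coeff_sub, coeff_mult isSymbol_lapSymbol, coeff_smooth zero_le_one,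
      coeff_zero_forcing hs hN (hUdiv t) (hdiv t ht), hmean t ht, smul_zero, smul_zero, sub_zero]
  have hD : Continuous fun t => timeDeriv N (U t) (V t) :=
    ((mult lapSymbol).continuous.comp hV).sub ((smooth 1).continuous.comp hG)
  have hDM : ∀ t, ‖timeDeriv N (U t) (V t)‖ ≤ (1 + ‖N‖ * (2 * ρ + M)) * M := fun t => by
    refine (norm_timeDeriv_le N (hUρ t)).trans ?_
    have := hVM t
    gcongr
  -- The time derivative lives two orders lower, hence `smooth 2`. The identity is checked on
  -- coefficients: nonzero modes by the integrated Duhamel formula, the zero mode because both sides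
  -- vanish.
  have hint : ∀ t, 0 ≤ t → smooth 2 (V t) = smooth 2 (V 0) +
      ∫ τ in (0 : ℝ)..t, timeDeriv N (U τ) (V τ) := by
    intro t ht
    refine ext_coeff fun ξ => ?_
    rw [coeff_add, ← coeffL_apply ξ (∫ τ in (0 : ℝ)..t, timeDeriv N (U τ) (V τ)),
      ← ContinuousLinearMap.intervalIntegral_comp_comm _ (hD.intervalIntegrable _ _)]
    simp only [coeffL_apply]
    by_cases hξ : ξ = 0
    · subst hξ
      rw [coeff_smooth zero_le_two, coeff_smooth zero_le_two, hmean t ht, hmean 0 le_rfl,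
        smul_zero, zero_add]
      symm
      rw [intervalIntegral.integral_of_le ht]
      exact setIntegral_eq_zero_of_forall_eq_zero fun τ hτ => hmean' τ hτ.1.le
    · have h1 := integral_eq_of_duhamel (l := freqSq ξ) (z := fun t => coeff (V t) ξ)
        (g := fun τ => bracket ξ • coeff (G τ) ξ) (z₀ := coeff V₀ ξ)
        (continuous_smul_coeff hG (bracket ξ) ξ) (fun t ht => by
          rw [hmild t ht, coeff_sub, coeff_mult (isSymbol_heatSymbol zero_le_one ht),
            coeff_conv_derivHeat hG hGM ht hξ, heatSymbol_of_ne _ _ hξ, sub_zero]) ht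
      rw [coeff_smooth zero_le_two, coeff_smooth zero_le_two]
      have h2 := congrArg (fun z => bracket ξ ^ (-2 : ℝ) • z) h1
      simp only [smul_add] at h2
      rw [h2, ← intervalIntegral.integral_smul]
      congr 2
      ext1 τ
      rw [timeDeriv, coeff_sub, coeff_mult isSymbol_lapSymbol, coeff_smooth zero_le_one, smul_sub,
        smul_smul, smul_smul, lapSymbol, mul_comm (bracket ξ ^ (-2 : ℝ))]
      congr 2
      nth_rw 2 [← Real.rpow_one (bracket ξ)]
      rw [← Real.rpow_add (bracket_pos ξ)]
      norm_num
  have hderiv : ∀ t, 0 ≤ t → HasDerivWithinAt (fun t => smooth 2 (V t))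
      (timeDeriv N (U t) (V t)) (Set.Ici 0) t := by
    intro t ht
    have h1 := ((hD.integral_hasStrictDerivAt 0 t).hasDerivAt.const_add
      (smooth 2 (V 0))).hasDerivWithinAt (s := Set.Ici 0)
    exact h1.congr (fun τ hτ => hint τ hτ) (hint t ht)
  have hsm : ∀ t, smooth s (V t) = smooth (s - 2) (smooth 2 (V t)) := fun t => by
    rw [smooth_smooth hσ zero_le_two, sub_add_cancel]
  refine ⟨contBddHs_smooth hs0 hV.continuousOn fun t _ => hVM t, ⟨?_,
    contBddHs_smooth hσ hD.continuousOn fun t _ => hDM t, fun t ht => ?_⟩, fun t ht => ?_,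
    fun t ht => ?_, fun t ht => (smooth_mem_divFree_iff hs0 _).mpr (hdiv t ht), fun t ht => ?_, ?_⟩
  · simp only [hsm]
    exact contBddHs_smooth hσ ((smooth 2).continuous.comp hV).continuousOn
      fun t _ => (norm_smooth_apply_le zero_le_two _).trans (hVM t)
  · simp only [hsm]
    exact hasTimeDeriv_smooth hσ (hderiv t ht)
  · rw [zeroMean_iff, coeff_smooth hs0, hmean t ht, smul_zero]
  · rw [zeroMean_iff, coeff_smooth hσ, hmean' t ht, smul_zero]
  · rw [← smooth_forcing hN, lap_smooth hs2.le, timeDeriv, map_sub,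
      smooth_smooth hσ zero_le_one, show s - 2 + 1 = s - 1 by ring]
    abel
  · congr 1
    have h0 : conv (derivHeat 0) G 0 = 0 := by
      unfold conv
      rw [setIntegral_indicator measurableSet_Iio, Set.Ioi_inter_Iio, Set.Ioo_self,
        setIntegral_empty]
    rw [hmild 0 le_rfl, h0, sub_zero]
    refine ext_coeff fun ξ => ?_
    rw [coeff_mult (isSymbol_heatSymbol zero_le_one le_rfl)]
    by_cases hξ : ξ = 0
    · rw [hξ, hV₀m, smul_zero]
    · rw [heatSymbol_of_ne _ _ hξ, mul_zero, Real.exp_zero, one_smul]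

/-- A classical solution solves the integral equation. -/
theorem IsPerturbationSolution.exists_mild (hd : 2 ≤ d) (hs : (d : ℝ) / 2 + 1 < s)
    (hN : ∀ A B, smooth (s - 1) (N A B) = leray (advect (smooth s A) (smooth s B)))
    {U : ℝ → L2 d d} {V₀ : L2 d d} {ρ : ℝ} (hU : Continuous U) (hUρ : ∀ t, ‖U t‖ ≤ ρ)
    {v dv : ℝ → L2 d d}
    (h : IsPerturbationSolution s (fun t => smooth s (U t)) (smooth s V₀) v dv) :
    ∃ (V : ℝ → L2 d d) (M : ℝ), Continuous V ∧ (∀ t, ‖V t‖ ≤ M) ∧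
      (∀ t, 0 ≤ t → smooth s (V t) = v t) ∧ ∀ t, 0 ≤ t → V t = mult (heatSymbol 0 t) V₀ -
        conv (derivHeat 0) (fun τ => forcing N (U τ) (V τ)) t := by
  have hs2 : 2 < s := by
    have : (2 : ℝ) ≤ d := by exact_mod_cast hd
    linarith
  have hs0 : 0 ≤ s := by linarith
  have hσ : 0 ≤ s - 2 := by linarith
  have hs1 : 0 ≤ s - 1 := by linarith
  obtain ⟨V', hV'v, hV'⟩ := h.regC0.1.exists_smooth hs0
  obtain ⟨M, hM⟩ := h.regC0.2
  -- The constant extension to negative times gives a curve continuous and bounded on the whole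
  -- line, as the convolution lemmas require.
  let V : ℝ → L2 d d := fun t => V' (max t 0)
  have hVv : ∀ t, 0 ≤ t → smooth s (V t) = v t := fun t ht => by
    change smooth s (V' (max t 0)) = v t
    rw [max_eq_left ht]
    exact hV'v t ht
  have hV : Continuous V :=
    hV'.comp_continuous (by fun_prop : Continuous fun t : ℝ => max t 0) fun t => le_max_right t 0
  have hVM : ∀ t, ‖V t‖ ≤ Real.sqrt (torusVol d) * M := fun t => by
    have h1 := hM (max t 0) (le_max_right t 0)
    rw [← hV'v _ (le_max_right t 0), hsNorm_smooth hs0, inv_mul_le_iff₀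
      (Real.sqrt_pos.mpr (torusVol_pos d))] at h1
    exact h1
  have hρ0 : 0 ≤ ρ := (norm_nonneg _).trans (hUρ 0)
  have hM0 : 0 ≤ Real.sqrt (torusVol d) * M := (norm_nonneg _).trans (hVM 0)
  have hG : Continuous fun τ => forcing N (U τ) (V τ) := continuous_forcing N hU hV
  have hGM : ∀ τ, ‖forcing N (U τ) (V τ)‖ ≤ ‖N‖ * (2 * ρ + Real.sqrt (torusVol d) * M) *
      (Real.sqrt (torusVol d) * M) := fun τ => by
    refine (norm_forcing_le N (hUρ τ)).trans ?_
    have := hVM τ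
    gcongr
  refine ⟨V, _, hV, hVM, hVv, fun t ht => ext_coeff fun ξ => ?_⟩
  rw [coeff_sub, coeff_mult (isSymbol_heatSymbol zero_le_one ht)]
  by_cases hξ : ξ = 0
  · subst hξ
    have h1 := (zeroMean_iff _).mp (h.mean t ht)
    rw [← hVv t ht, coeff_smooth hs0] at h1
    rw [(smul_eq_zero.mp h1).resolve_left (Real.rpow_pos_of_pos (bracket_pos _) _).ne',
      coeff_conv le_rfl one_pos hG hGM ht]
    simp [derivHeatSymbol, heatSymbol_zero_freq]
  -- Multiplying the equation at frequency `ξ` by `⟨ξ⟩^s` turns `v` into `V`; the forcing, which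
  -- sits at level `s - 1`, keeps one factor `⟨ξ⟩`.
  · have hz : ∀ τ, 0 ≤ τ → HasDerivWithinAt (fun τ => coeff (V τ) ξ)
        (-freqSq ξ • coeff (V τ) ξ - bracket ξ • coeff (forcing N (U τ) (V τ)) ξ)
        (Set.Ici 0) τ := by
      intro τ hτ
      have hb := bracket_pos ξ
      have hinv : ∀ z : EuclideanSpace ℂ (Fin d), bracket ξ ^ s • bracket ξ ^ (-s) • z = z := by
        intro z
        rw [smul_smul, ← Real.rpow_add hb, add_neg_cancel, Real.rpow_zero, one_smul]
      have h1 := ((h.regC1.2.2 τ hτ).coeff hσ hτ ξ).const_smul (bracket ξ ^ s)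
      have h2 : bracket ξ ^ s • coeff (dv τ) ξ =
          -freqSq ξ • coeff (V τ) ξ - bracket ξ • coeff (forcing N (U τ) (V τ)) ξ := by
        have h3 := h.eqn τ hτ
        rw [← hVv τ hτ, ← smooth_forcing hN] at h3
        have h4 : dv τ = lap (smooth s (V τ)) - smooth (s - 1) (forcing N (U τ) (V τ)) := by
          rw [← sub_eq_zero, ← h3]
          abel
        rw [h4, coeff_sub, coeff_lap ((memHs_smooth hs0 _).mono hs2.le), coeff_smooth hs0,
          coeff_smooth hs1, smul_sub, smul_comm, hinv, smul_smul, ← Real.rpow_add hb]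
        congr 2
        rw [show s + -(s - 1) = 1 by ring, Real.rpow_one]
      rw [h2] at h1
      refine h1.congr (fun r hr => ?_) ?_
      · simp only [Pi.smul_apply]
        rw [← hVv r hr, coeff_smooth hs0, hinv]
      · simp only [Pi.smul_apply]
        rw [← hVv τ hτ, coeff_smooth hs0, hinv]
    have h1 := duhamel_of_hasDerivWithinAt (l := freqSq ξ) (z := fun τ => coeff (V τ) ξ)
      (g := fun τ => bracket ξ • coeff (forcing N (U τ) (V τ)) ξ)
      (continuous_smul_coeff hG (bracket ξ) ξ) hz ht
    have h0 : V 0 = V₀ := smooth_injective hs0 (by rw [hVv 0 le_rfl, h.init])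
    rw [h0] at h1
    rw [coeff_conv_derivHeat hG hGM ht hξ, heatSymbol_of_ne _ _ hξ, sub_zero]
    exact h1

end Perturbation

/-! ### Decaying solutions and uniqueness -/

section Stability

variable {d : ℕ} {s : ℝ} {N : L2 d d →L[ℝ] L2 d d →L[ℝ] L2 d d}

theorem continuous_flow {ν : ℕ} (ω : Fin ν → ℝ) : Continuous (flow ω) :=
  continuous_pi fun k => (AddCircle.continuous_mk' _).comp (by fun_prop)

/-- The lift to `L²` of a continuous bounded curve of divergence free fields of `H^s`. -/
theorem IsQuasiPeriodicSolution.exists_lift {ν : ℕ} {K ε : ℝ} (hs : 0 ≤ s) {ω : Fin ν → ℝ}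
    {f : C(Torus ν × Torus d, Vec d)} {U : Torus ν → L2 d d} {P : Torus ν → L2 d 1}
    (h : IsQuasiPeriodicSolution s K ε ω f U P) :
    ∃ A : ℝ → L2 d d, Continuous A ∧ (∀ t, ‖A t‖ ≤ Real.sqrt (torusVol d) * (K * ε)) ∧
      (∀ t, A t ∈ divFree d) ∧ ∀ t, smooth s (A t) = U (flow ω t) := by
  obtain ⟨A, hA, hAc⟩ := h.regU.1.exists_smooth hs
  have hA' : ∀ φ, smooth s (A φ) = U φ := fun φ => hA φ (Set.mem_univ φ)
  refine ⟨fun t => A (flow ω t), (continuousOn_univ.mp hAc).comp (continuous_flow ω),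
    fun t => ?_, fun t => ?_, fun t => hA' _⟩
  · have h1 := h.regU.2.1 (flow ω t)
    rwa [← hA', hsNorm_smooth hs,
      inv_mul_le_iff₀ (Real.sqrt_pos.mpr (torusVol_pos d))] at h1
  · rw [← smooth_mem_divFree_iff hs, hA']
    exact (h.solves t).1

/-- The truncation `max t 0` keeps the symbols bounded by 1; for negative times the heat symbol is
unbounded. -/
theorem continuous_mult_heatSymbol {a : ℝ} (ha : a ≤ 1) (V₀ : L2 d d) :
    Continuous fun t => mult (heatSymbol a (max t 0)) V₀ := by
  refine continuous_iff_continuousAt.mpr fun t => ?_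
  refine tendsto_mult (M := 1) (Eventually.of_forall fun r =>
    isSymbol_heatSymbol ha (le_max_right r 0)) (isSymbol_heatSymbol ha (le_max_right t 0))
    (Eventually.of_forall fun r => abs_heatSymbol_le ha (le_max_right r 0)) (fun ξ => ?_) V₀
  exact ((continuous_heatSymbol a ξ).comp (by fun_prop : Continuous fun t : ℝ => max t 0)).tendsto t

/-- Small solutions of the integral equation, with exponential decay. -/
theorem exists_decaying_mild {α η ρ : ℝ} (hα0 : 0 ≤ α) (hα1 : α < 1) {U : ℝ → L2 d d}
    (hU : Continuous U) (hUρ : ∀ t, ‖U t‖ ≤ ρ) {V₀ : L2 d d} (hV₀ : ‖V₀‖ ≤ η)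
    (hsmall : (∫ r in Set.Ioi (0 : ℝ), heatBound α r) * (‖N‖ * (2 * ρ + 4 * η)) ≤ 1 / 2) :
    ∃ V : ℝ → L2 d d, Continuous V ∧ (∀ t, ‖V t‖ ≤ 2 * η * Real.exp (-α * |t|)) ∧
      ∀ t, 0 ≤ t → V t = mult (heatSymbol 0 t) V₀ -
        conv (derivHeat 0) (fun τ => forcing N (U τ) (V τ)) t := by
  have hη : 0 ≤ η := (norm_nonneg _).trans hV₀
  have hy : ∀ t, ‖mult (heatSymbol α (max t 0)) V₀‖ ≤ η := fun t => by
    refine (ContinuousLinearMap.le_opNorm _ _).trans ?_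
    refine (mul_le_mul_of_nonneg_right (norm_mult_le
      (isSymbol_heatSymbol hα1.le (le_max_right t 0)) zero_le_one
      (abs_heatSymbol_le hα1.le (le_max_right t 0))) (norm_nonneg _)).trans ?_
    rwa [one_mul]
  have he : ∀ t : ℝ, |Real.exp (-α * |t|)| ≤ 1 := fun t => by
    rw [abs_of_nonneg (Real.exp_pos _).le, Real.exp_le_one_iff]
    have := abs_nonneg t
    nlinarith
  -- `W` stands for `e^{αt}V`: the kernel is that of `Δ + α`, and the quadratic term keeps one
  -- factor `e^{-α|τ|}`. The absolute value bounds this factor by 1 at negative times too.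
  obtain ⟨W, hW, hWη, hWeq⟩ := exists_mild_solution
    (isKernel_derivHeat (d := d) (n := d) hα0 hα1) N (e := fun τ => Real.exp (-α * |τ|))
    (y := fun t => mult (heatSymbol α (max t 0)) V₀) hη
    (continuous_mult_heatSymbol hα1.le V₀) hy hU hUρ (by fun_prop) he hsmall
  refine ⟨fun t => Real.exp (-α * |t|) • W t, by fun_prop, fun t => ?_, fun t ht => ?_⟩
  · rw [norm_smul, Real.norm_of_nonneg (Real.exp_pos _).le, mul_comm]
    exact mul_le_mul_of_nonneg_right (hWη t) (Real.exp_pos _).le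
  · simp only [hWeq t, smul_sub]
    congr 1
    · refine ext_coeff fun ξ => ?_
      rw [max_eq_left ht, abs_of_nonneg ht, coeff_smul,
        coeff_mult (isSymbol_heatSymbol hα1.le ht),
        coeff_mult (isSymbol_heatSymbol zero_le_one ht), heatSymbol_eq α, smul_smul, ← mul_assoc,
        ← Real.exp_add, neg_mul, neg_add_cancel, Real.exp_zero, one_mul]
    · unfold conv
      rw [← integral_smul]
      refine setIntegral_congr_fun measurableSet_Ioi fun r hr => ?_
      have hr : 0 < r := hr
      by_cases hrt : r ∈ Set.Iio t
      · have htr : 0 < t - r := sub_pos.mpr hrt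
        simp only [Set.indicator_of_mem hrt]
        have e1 : forcing N (U (t - r)) (Real.exp (-α * |t - r|) • W (t - r)) =
            Real.exp (-α * |t - r|) • (N (U (t - r)) (W (t - r)) + N (W (t - r)) (U (t - r)) +
              Real.exp (-α * |t - r|) • N (W (t - r)) (W (t - r))) := by
          simp only [forcing, map_smul, smul_apply, smul_add]
        rw [e1, map_smul]
        refine ext_coeff fun ξ => ?_
        rw [derivHeat, derivHeat, coeff_smul, coeff_smul,
          coeff_mult (isSymbol_derivHeatSymbol hα0 hα1 hr),
          coeff_mult (isSymbol_derivHeatSymbol le_rfl one_pos hr), smul_smul, smul_smul,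
          derivHeatSymbol, derivHeatSymbol, heatSymbol_eq α, abs_of_nonneg ht,
          abs_of_nonneg htr.le]
        -- The exponentials match because `e^{-αt}e^{αr} = e^{-α(t-r)}`.
        congr 1
        rw [mul_left_comm (bracket ξ), ← mul_assoc, ← Real.exp_add]
        congr 2
        ring
      · simp only [Set.indicator_of_notMem hrt, smul_zero]

theorem IsPerturbationSolution.unique (hd : 2 ≤ d) (hs : (d : ℝ) / 2 + 1 < s)
    (hN : ∀ A B, smooth (s - 1) (N A B) = leray (advect (smooth s A) (smooth s B)))
    {U : ℝ → L2 d d} {V₀ : L2 d d} {ρ : ℝ} (hU : Continuous U) (hUρ : ∀ t, ‖U t‖ ≤ ρ)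
    {v dv v' dv' : ℝ → L2 d d}
    (h : IsPerturbationSolution s (fun t => smooth s (U t)) (smooth s V₀) v dv)
    (h' : IsPerturbationSolution s (fun t => smooth s (U t)) (smooth s V₀) v' dv') :
    ∀ t, 0 ≤ t → v' t = v t := by
  obtain ⟨V, M, hV, hVM, hVv, hVeq⟩ := h.exists_mild hd hs hN hU hUρ
  obtain ⟨V', M', hV', hVM', hVv', hVeq'⟩ := h'.exists_mild hd hs hN hU hUρ
  have hρ0 : 0 ≤ ρ := (norm_nonneg _).trans (hUρ 0)
  have hM0 : 0 ≤ M := (norm_nonneg _).trans (hVM 0)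
  have hM0' : 0 ≤ M' := (norm_nonneg _).trans (hVM' 0)
  have hb : ∀ {V : ℝ → L2 d d} {M : ℝ}, 0 ≤ M → (∀ t, ‖V t‖ ≤ M) →
      ∀ τ, ‖forcing N (U τ) (V τ)‖ ≤ ‖N‖ * (2 * ρ + M) * M := by
    intro V M hM0 hVM τ
    refine (norm_forcing_le N (hUρ τ)).trans ?_
    have := hVM τ
    gcongr
  have key := mild_unique (isKernel_derivHeat (d := d) (n := d) le_rfl one_pos)
    (y := fun t => mult (heatSymbol 0 t) V₀) (D := M' + M)
    (L := ‖N‖ * (2 * ρ + 2 * max M M')) (by positivity)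
    (continuous_forcing N hU hV') (hb hM0' hVM') (continuous_forcing N hU hV) (hb hM0 hVM)
    hVeq' hVeq
    (fun τ _ => norm_forcing_sub_le N (hUρ τ) ((hVM' τ).trans (le_max_right M M'))
      ((hVM τ).trans (le_max_left M M')))
    (fun τ _ => (norm_sub_le _ _).trans (add_le_add (hVM' τ) (hVM τ)))
  intro t ht
  rw [← hVv t ht, ← hVv' t ht, key t ht]

end Stability

end

end NSTorus

/-! ### The stability theorem -/

open NSTorus

theorem proposition4p1 (d ν : ℕ) (hd : 2 ≤ d) (s α K : ℝ) (hs : (d : ℝ) / 2 + 1 < s)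
    (hα : α ∈ Set.Ioo (0 : ℝ) 1) (hK : 0 < K) :
    ∃ δ ∈ Set.Ioo (0 : ℝ) 1, ∃ C : ℝ, 0 < C ∧
      ∀ ε ∈ Set.Ioo (0 : ℝ) δ,
      ∀ (ω : Fin ν → ℝ) (f : C(NSTorus.Torus ν × NSTorus.Torus d, NSTorus.Vec d))
        (U : NSTorus.Torus ν → NSTorus.L2 d d) (P : NSTorus.Torus ν → NSTorus.L2 d 1),
      NSTorus.IsQuasiPeriodicSolution s K ε ω f U P →
      ∀ v₀ : NSTorus.L2 d d, NSTorus.MemHs s v₀ → NSTorus.ZeroMean v₀ → v₀ ∈ NSTorus.divFree d →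
        NSTorus.hsNorm s v₀ ≤ δ →
        ∃ v dv : ℝ → NSTorus.L2 d d,
          NSTorus.IsPerturbationSolution s (fun t => U (NSTorus.flow ω t)) v₀ v dv ∧
          (∀ t : ℝ, 0 ≤ t →
            NSTorus.hsNorm s (v t) ≤ C * δ * Real.exp (-α * t) ∧
            NSTorus.hsNorm (s - 2) (dv t) ≤ C * δ * Real.exp (-α * t)) ∧
          ∀ v' dv' : ℝ → NSTorus.L2 d d,
            NSTorus.IsPerturbationSolution s (fun t => U (NSTorus.flow ω t)) v₀ v' dv' →
            ∀ t : ℝ, 0 ≤ t → v' t = v t := by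
  obtain ⟨N, hN⟩ := exists_bilinear hs
  have hs2 : 2 < s := by
    have : (2 : ℝ) ≤ d := by exact_mod_cast hd
    linarith
  have hs0 : 0 ≤ s := by linarith
  have hσ : 0 ≤ s - 2 := by linarith
  set q := Real.sqrt (torusVol d) with hq
  have hq0 : 0 < q := Real.sqrt_pos.mpr (torusVol_pos d)
  set κ := ∫ r in Set.Ioi (0 : ℝ), heatBound α r with hκ
  have hκ0 : 0 ≤ κ := MeasureTheory.setIntegral_nonneg measurableSet_Ioi fun r hr =>
    heatBound_nonneg hα.2 hr
  -- With `ρ = qKδ` for the background flow and `η = qδ` for the datum, the smallness condition of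
  -- `exists_decaying_mild` reads `Qδ ≤ 1/2`; the factor `q` converts `H^s` norms to `L²` norms of
  -- the lifts.
  set Q := κ * (‖N‖ * (2 * (q * K) + 4 * q)) with hQ
  have hQ0 : 0 ≤ Q := by positivity
  -- The 2 is the radius factor in `‖V‖ ≤ 2η e^{-αt}`; the bracket bounds the factor in
  -- `norm_timeDeriv_le`, using `δ ≤ 1`.
  set C := 2 * (1 + ‖N‖ * (2 * (q * K) + 2 * q)) with hC
  have hC2 : 2 ≤ C := by
    have : 0 ≤ ‖N‖ * (2 * (q * K) + 2 * q) := by positivity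
    linarith
  -- The added 1 covers `Q = 0` and gives `δ < 1` together with `Qδ ≤ 1/2`.
  set δ := 1 / (2 * (Q + 1)) with hδ
  have hδ0 : 0 < δ := by positivity
  have hδ1 : δ < 1 := by
    rw [hδ, div_lt_one (by positivity)]
    linarith
  have hQδ : Q * δ ≤ 1 / 2 := by
    rw [hδ, mul_one_div, div_le_div_iff₀ (by positivity) (by norm_num)]
    linarith
  refine ⟨δ, ⟨hδ0, hδ1⟩, C, by linarith, fun ε hε ω f U P hUP v₀ hv₀ hv₀m hv₀d hv₀δ => ?_⟩
  obtain ⟨A, hA, hAb, hAd, hAU⟩ := hUP.exists_lift hs0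
  have hAρ : ∀ t, ‖A t‖ ≤ q * K * δ := fun t => (hAb t).trans (by
    rw [← mul_assoc]
    have := hε.2.le
    gcongr)
  obtain ⟨V₀, rfl⟩ := hv₀.exists_smooth hs0
  have hV₀ : ‖V₀‖ ≤ q * δ := by
    rwa [hsNorm_smooth hs0, inv_mul_le_iff₀ hq0] at hv₀δ
  have hV₀m : coeff V₀ 0 = 0 := by
    have h1 := (zeroMean_iff _).mp hv₀m
    rw [coeff_smooth hs0] at h1
    exact (smul_eq_zero.mp h1).resolve_left (Real.rpow_pos_of_pos (bracket_pos _) _).ne'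
  obtain ⟨V, hV, hVb, hVeq⟩ := exists_decaying_mild (N := N) hα.1.le hα.2 hA hAρ hV₀ (by
    refine le_trans (le_of_eq ?_) hQδ
    rw [hQ]
    ring)
  have hVM : ∀ t, ‖V t‖ ≤ 2 * (q * δ) := fun t => (hVb t).trans (by
    refine mul_le_of_le_one_right (by positivity) (Real.exp_le_one_iff.mpr ?_)
    have := abs_nonneg t
    have := hα.1
    nlinarith)
  have hsol := isPerturbationSolution_of_mild hd hs hN hA hAρ hAd hV hVM
    ((smooth_mem_divFree_iff hs0 V₀).mp hv₀d) hV₀m hVeq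
  simp only [hAU] at hsol
  refine ⟨_, _, hsol, fun t ht => ⟨?_, ?_⟩, fun v' dv' hv' => ?_⟩
  · rw [hsNorm_smooth hs0, inv_mul_le_iff₀ hq0]
    refine (hVb t).trans ?_
    rw [abs_of_nonneg ht]
    have : 0 ≤ q * δ * Real.exp (-α * t) := by positivity
    nlinarith
  · rw [hsNorm_smooth hσ, inv_mul_le_iff₀ hq0]
    refine (norm_timeDeriv_le N (hAρ t)).trans ?_
    have h1 : 1 + ‖N‖ * (2 * (q * K * δ) + ‖V t‖) ≤ 1 + ‖N‖ * (2 * (q * K) + 2 * q) := by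
      have h2 : q * K * δ ≤ q * K := mul_le_of_le_one_right (by positivity) hδ1.le
      have h3 : ‖V t‖ ≤ 2 * q := (hVM t).trans (by nlinarith)
      gcongr
    have h4 := hVb t
    rw [abs_of_nonneg ht] at h4
    refine (mul_le_mul h1 h4 (norm_nonneg _) (by positivity)).trans_eq ?_
    rw [hC]
    ring
  · have e : (fun t => U (flow ω t)) = fun t => smooth s (A t) := funext fun t => (hAU t).symm
    rw [e] at hsol hv'
    exact hsol.unique hd hs hN hA hAρ hv'
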